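/- Let $n\ge 3$ and consider in $\mathbb R^n$ the sets $$K_1=\{x_1^2+\dots+x_{n-1}^2=4,\ x_n=0\},\qquad K_2=\{x_2^2+\dots+x_n^2=9,\ x_1=0\},$$ $$K_3=\{x_1^2+\tfrac{x_n^2}{16}=1,\ x_2=\dots=x_{n-1}=0\}.$$ Here a knot in $\mathbb R^n$ is a subset homeomorphic to a sphere $S^k$ for some $k$; it bounds a ball $B$ if $B$ is the image of an embedding of the closed $(k+1)$-ball into $\mathbb R^n$ that carries the boundary sphere onto the knot; it is convex if it bounds a convex ball. A link is a finite family of pairwise disjoint knots. It is an unlink if every component bounds a ball that is disjoint from all the other components. It is Brunnian if it has at least three components, is not an unlink, and every proper sublink is an unlink. Then the link $L_{1,n}=K_1\cup K_2\cup K_3$, with components $K_1,K_2,K_3$, is a Brunnian link all of whose components are convex. Moreover, the group $\pi_1(\mathbb R^n-(K_1\cup K_2),0)$ is free on the two classes of the loops $$\alpha(t)=(3\sin 2\pi t,0,\dots,0,3-3\cos 2\pi t),\qquad \beta(t)=(2-2\cos 2\pi t,0,\dots,0,2\sin 2\pi t)\qquad(0\le t\le 1).$$ If $\kappa(t)=(\cos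 2\pi t,0,\dots,0,4\sin 2\pi t)$ is the ellipse $K_3$ run through once and $\gamma(t)=(t,0,\dots,0)$, then in $\mathbb R^n-(K_1\cup K_2)$ the loop $\gamma\kappa\gamma^{-1}$ is homotopic, with endpoints fixed, to the commutator $\alpha\beta^{-1}\alpha^{-1}\beta$, and it is not null-homotopic. (Paths are composed from left to right.) -/

import Mathlib

open scoped unitInterval

/-- Euclidean `n`-space. The coordinates `x₁, …, xₙ` are `x 0, …, x (n - 1)`. -/
abbrev Rn (n : ℕ) : Type := EuclideanSpace ℝ (Fin n)

/-- A knot in `ℝⁿ`: a subset homeomorphic to the sphere `S^k` for some `k`. -/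
def IsKnot {n : ℕ} (K : Set (Rn n)) : Prop :=
  ∃ k : ℕ, Nonempty (K ≃ₜ Metric.sphere (0 : Rn (k + 1)) 1)

/-- `K` bounds the (embedded) ball `B`: for some `k`, the set `B` is the image of the closed unit
ball of `ℝ^(k+1)` under a continuous injective map (an embedding, by compactness) that carries the
boundary sphere `S^k` onto `K`. -/
def BoundsBall {n : ℕ} (K B : Set (Rn n)) : Prop :=
  ∃ (k : ℕ) (f : Rn (k + 1) → Rn n),
    ContinuousOn f (Metric.closedBall 0 1) ∧
    Set.InjOn f (Metric.closedBall 0 1) ∧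
    f '' Metric.closedBall 0 1 = B ∧
    f '' Metric.sphere 0 1 = K

/-- A knot is convex if it bounds a convex ball. -/
def IsConvexKnot {n : ℕ} (K : Set (Rn n)) : Prop :=
  IsKnot K ∧ ∃ B : Set (Rn n), BoundsBall K B ∧ Convex ℝ B

/-- A link in `ℝⁿ`, given by the family of its components: finitely many pairwise disjoint
knots, possibly of different dimensions. -/
def IsLink {n : ℕ} {ι : Type} [Finite ι] (F : ι → Set (Rn n)) : Prop :=
  (∀ i, IsKnot (F i)) ∧ ∀ i j, i ≠ j → Disjoint (F i) (F j)

/-- An unlink in `ℝⁿ`: every component bounds a ball that misses all other components. -/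
def IsUnlink {n : ℕ} {ι : Type} [Finite ι] (F : ι → Set (Rn n)) : Prop :=
  IsLink F ∧
    ∀ i, ∃ B : Set (Rn n), BoundsBall (F i) B ∧ ∀ j, j ≠ i → Disjoint B (F j)

/-- A Brunnian link in `ℝⁿ`: a link of at least three components that is not an unlink, although
every proper sublink is an unlink. -/
def IsBrunnianLink {n : ℕ} {ι : Type} [Finite ι] (F : ι → Set (Rn n)) : Prop :=
  IsLink F ∧ 3 ≤ Nat.card ι ∧ ¬ IsUnlink F ∧
    ∀ s : Set ι, s ≠ Set.univ → IsUnlink (fun i : s => F i)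

/-- A convex Brunnian link: a Brunnian link all of whose components are convex. -/
def IsConvexBrunnianLink {n : ℕ} {ι : Type} [Finite ι] (F : ι → Set (Rn n)) : Prop :=
  IsBrunnianLink F ∧ ∀ i, IsConvexKnot (F i)

/-- `K₁ = {x₁² + ⋯ + xₙ₋₁² = 4, xₙ = 0}`. -/
def knotK1 (n : ℕ) : Set (Rn n) :=
  {x | (∑ j ∈ Finset.univ.filter (fun j : Fin n => (j : ℕ) + 1 < n), x j ^ 2) = 4 ∧
    ∀ j : Fin n, (j : ℕ) + 1 = n → x j = 0}

/-- `K₂ = {xᵢ₊₁² + ⋯ + xₙ² = 9, x₁ = ⋯ = xᵢ = 0}`. -/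
def knotK2 (i n : ℕ) : Set (Rn n) :=
  {x | (∑ j ∈ Finset.univ.filter (fun j : Fin n => i ≤ (j : ℕ)), x j ^ 2) = 9 ∧
    ∀ j : Fin n, (j : ℕ) < i → x j = 0}

/-- `K₃ = {x₁² + ⋯ + xᵢ² + xₙ² / 16 = 1, xᵢ₊₁ = ⋯ = xₙ₋₁ = 0}`; the second sum below has the
single term `xₙ² / 16`. -/
def knotK3 (i n : ℕ) : Set (Rn n) :=
  {x | (∑ j ∈ Finset.univ.filter (fun j : Fin n => (j : ℕ) < i), x j ^ 2) +
      (∑ j ∈ Finset.univ.filter (fun j : Fin n => (j : ℕ) + 1 = n), x j ^ 2 / 16) = 1 ∧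
    ∀ j : Fin n, i ≤ (j : ℕ) → (j : ℕ) + 1 < n → x j = 0}

/-- The three-component link `L_{i,n} = K₁ ∪ K₂ ∪ K₃` (of interest for `1 ≤ i ≤ n - 2`), as the
family of its components. -/
def linkL (i n : ℕ) : Fin 3 → Set (Rn n) :=
  ![knotK1 n, knotK2 i n, knotK3 i n]

/-- The complement `ℝⁿ - (K₁ ∪ K₂)` for `i = 1`. -/
abbrev complK1K2 (n : ℕ) : Type := {x : Rn n // x ∉ knotK1 n ∪ knotK2 1 n}

/-- The point `(a, 0, …, 0, b)` of `ℝⁿ`. -/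
noncomputable def planePoint (n : ℕ) (a b : ℝ) : Rn n :=
  WithLp.toLp 2 fun j : Fin n => if (j : ℕ) = 0 then a else if (j : ℕ) + 1 = n then b else 0

/-!
Write `n = m + 3`, and let `U` be the complement of the two spheres `K₁` and `K₂`.

*The fundamental group of `U`.* The star region, that is `ℝⁿ` without `{xₙ = 0, ‖x‖ ≥ 2}` and
`{x₁ = 0, ‖x‖ ≥ 3}`, is star-shaped around the origin. A path in `U` between two points of it becomes
a loop at the origin when the radial segments to its endpoints are attached (`radialLoop`), and this
operation is compatible with composition. A path in a convex subset of `U` on one side of the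
hyperplane `xₙ = 0` that crosses the hyperplane `x₁ = 0` outside of `K₂` can be pushed to infinity in
the direction of `xₙ`; so the class of its loop depends only on this side and on the sense of the
crossing (`radialLoop_eq_of_isOuter`). The same holds with the two hyperplanes, and `K₁` in place of
`K₂`, exchanged. Hence there are only four classes of loops, up to inversion. Two of them are
`α` (`radialLoop_top`) and `β` (`radialLoop_right`). The other two are found by going around small
squares centred on the second coordinate axis, which is where `n ≥ 3` enters: at a point between
the two spheres, `radialLoop_left` gives `β` again, and at a point outside of both,
`radialLoop_bottom` gives `β⁻¹ α⁻¹ β`. The ellipse crosses `x₁ = 0` twice, once at the top and once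
at the bottom, which makes it `α · β⁻¹ α⁻¹ β` (`gamma_kappa_homotopic`).

The classes of `α` and `β` generate (`mem_of_alpha_beta_mem`): a path is cut into pieces in small
balls, and, the endpoints being moved off the two hyperplanes, each piece is homotopic to a path
that crosses first the one and then the other hyperplane.

They generate freely (`freeGroupHom_injective`): for every group `G` with two elements `a` and `b`
there is a `G`-covering of `U` with the monodromy `α ↦ a`, `β ↦ b`. It is glued from two trivial
pieces (`clutchingBundle`) with a transition function that jumps by `b` across the disc
`{xₙ = 0, ‖x‖ < 2}` and by `a` across `{x₁ = 0, ‖x‖ > 3}`. For `G` the free group, its monodromy is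
left multiplication, so that a word acting trivially is trivial.

*The link.* Each knot is the image of a unit sphere under a scaled coordinate embedding, and the ball
can be embedded with this boundary so as to bulge in a further coordinate direction (`dome`). With
suitable heights one avoids either of the other two components, and height `0` gives a convex
ball. A ball bounded by `K₃` that misses `K₁` and `K₂` would make the ellipse null-homotopic in `U`;
but its class is a nontrivial commutator of free generators (`not_isUnlink_linkL`).
-/

open scoped unitInterval Pointwise

open Set
open Path.Homotopic.Quotient (mk)
open Path.Homotopic.Quotient

/-! ### Paths and homotopies -/

/-- Two paths with the same endpoints that run inside a star-convex set are homotopic in every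
subspace of the ambient vector space that contains this set. -/
theorem homotopic_of_starConvex {E : Type*} [AddCommGroup E] [Module ℝ E] [TopologicalSpace E]
    [ContinuousAdd E] [ContinuousSMul ℝ E] {P : E → Prop} {S : Set E} {c : E}
    (hS : StarConvex ℝ c S) (hSP : ∀ z ∈ S, P z) {x y : {z : E // P z}} (p q : Path x y)
    (hp : ∀ t, (p t : E) ∈ S) (hq : ∀ t, (q t : E) ∈ S) : p.Homotopic q := by
  have : ContractibleSpace S := hS.contractibleSpace ⟨_, hp 0⟩
  have hx : (x : E) ∈ S := by simpa using hp 0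
  have hy : (y : E) ∈ S := by simpa using hp 1
  let lift (r : Path x y) (hr : ∀ t, (r t : E) ∈ S) : Path (⟨x, hx⟩ : S) ⟨y, hy⟩ :=
    { toFun := fun t ↦ ⟨r t, hr t⟩
      source' := by simp
      target' := by simp }
  have h := SimplyConnectedSpace.paths_homotopic (lift p hp) (lift q hq)
  let j : C(S, {z : E // P z}) := ⟨fun z ↦ ⟨z, hSP z z.2⟩, by fun_prop⟩
  exact h.map j

/-- The straight path between two points of a subspace of a vector space that contains the segment
between them. -/
noncomputable def segmentPath {E : Type*} [AddCommGroup E] [Module ℝ E] [TopologicalSpace E]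
    [IsTopologicalAddGroup E] [ContinuousSMul ℝ E] {P : E → Prop} (x y : {z : E // P z})
    (h : ∀ z ∈ segment ℝ (x : E) y, P z) : Path x y where
  toFun t := ⟨AffineMap.lineMap (x : E) (y : E) (t : ℝ), h _ <| by
    rw [segment_eq_image_lineMap]; exact mem_image_of_mem _ t.2⟩
  continuous_toFun := by
    simp only [AffineMap.lineMap_apply_module]
    fun_prop
  source' := by simp
  target' := by simp

theorem segmentPath_mem {E : Type*} [AddCommGroup E] [Module ℝ E] [TopologicalSpace E]
    [IsTopologicalAddGroup E] [ContinuousSMul ℝ E] {P : E → Prop} (x y : {z : E // P z})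
    (h : ∀ z ∈ segment ℝ (x : E) y, P z) (t : I) :
    (segmentPath x y h t : E) ∈ segment ℝ (x : E) y := by
  rw [segment_eq_image_lineMap]
  exact mem_image_of_mem _ t.2

namespace Path.Homotopic.Quotient

variable {X : Type*} [TopologicalSpace X] {x y z w : X}

theorem symm_trans_rev (a : Path.Homotopic.Quotient x y) (b : Path.Homotopic.Quotient y z) :
    (a.trans b).symm = b.symm.trans a.symm := by
  induction a, b using Path.Homotopic.Quotient.ind₂ with
  | mk a b => rw [← mk_trans, ← mk_symm, Path.trans_symm]; rfl

theorem symm_symm (a : Path.Homotopic.Quotient x y) : a.symm.symm = a := by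
  induction a using Path.Homotopic.Quotient.ind with
  | mk a => rw [← mk_symm, ← mk_symm, Path.symm_symm]

theorem trans_symm_cancel (a : Path.Homotopic.Quotient x y) (b : Path.Homotopic.Quotient x z) :
    a.trans (a.symm.trans b) = b := by
  rw [← trans_assoc, trans_symm, refl_trans]

theorem symm_trans_cancel (a : Path.Homotopic.Quotient x y) (b : Path.Homotopic.Quotient y z) :
    a.symm.trans (a.trans b) = b := by
  rw [← trans_assoc, symm_trans, refl_trans]

theorem mk_subpath_trans (p : Path x y) (r s t : I) :
    (mk (p.subpath r s)).trans (mk (p.subpath s t)) = mk (p.subpath r t) :=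
  Path.Homotopic.Quotient.eq.2 ⟨Path.Homotopy.subpathTransSubpath p r s t⟩

end Path.Homotopic.Quotient

theorem Path.subpath_mem {X : Type*} [TopologicalSpace X] {a b : X} (p : Path a b) {r s : I}
    (hrs : r ≤ s) {S : Set X} (h : ∀ t, r ≤ t → t ≤ s → p t ∈ S) (t : I) :
    p.subpath r s t ∈ S := by
  have : p.subpath r s t ∈ p '' Icc r s := by
    rw [← Path.range_subpath_of_le p r s hrs]; exact mem_range_self t
  obtain ⟨u, hu, hu'⟩ := this
  exact hu' ▸ h u hu.1 hu.2

/-- Let a set `A x` of homotopy classes of paths from `o` to `x` be given for every point `x`, such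
that, locally, every path carries some member of `A` to a member of `A`. If any two members of `A x`
differ by an element of a subgroup `H` of the fundamental group, then `H` is the whole group. -/
theorem mem_of_locally_admissible {X : Type*} [TopologicalSpace X] {o : X}
    (H : Subgroup (FundamentalGroup X o)) (A : ∀ x : X, Set (Path.Homotopic.Quotient o x))
    (h_one : Path.Homotopic.Quotient.refl o ∈ A o)
    (h_diff : ∀ x, ∀ q ∈ A x, ∀ q' ∈ A x, FundamentalGroup.fromPath (q.trans q'.symm) ∈ H)
    (h_loc : ∀ x : X, ∃ N : Set X, IsOpen N ∧ x ∈ N ∧ ∀ z z' (p : Path z z'), (∀ t, p t ∈ N) →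
      ∃ q ∈ A z, q.trans (mk p) ∈ A z')
    (g : FundamentalGroup X o) : g ∈ H := by
  obtain ⟨p, rfl⟩ := Path.Homotopic.Quotient.mk_surjective g
  choose N hNo hN hNA using h_loc
  obtain ⟨t, ht0, htm, ⟨n, hn⟩, htc⟩ := exists_monotone_Icc_subset_open_cover_unitInterval
    (c := fun x : X ↦ p ⁻¹' N x) (fun x ↦ (hNo x).preimage p.continuous)
    (fun s _ ↦ mem_iUnion.2 ⟨p s, hN (p s)⟩)
  -- Each initial piece of `p`, closed up by a suitable member of `A`, represents an element of `H`.
  have key : ∀ k, ∃ q ∈ A (p (t k)), FundamentalGroup.fromPath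
      (((mk (p.subpath 0 (t k))).cast p.source.symm rfl).trans q.symm) ∈ H := by
    intro k
    induction k with
    | zero =>
      have aux : ∀ z w (hw : w = z) (hz : z = o), ∃ q ∈ A w, FundamentalGroup.fromPath
          (((mk (Path.refl z)).cast hz.symm hw).trans q.symm) ∈ H := by
        rintro z w rfl rfl
        exact ⟨_, h_one, by simp only [mk_refl, cast_rfl_rfl, trans_symm]; exact H.one_mem⟩
      have aux' : ∀ s, s = 0 → ∃ q ∈ A (p s), FundamentalGroup.fromPath
          (((mk (p.subpath 0 s)).cast p.source.symm rfl).trans q.symm) ∈ H := by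
        rintro s rfl
        rw [Path.subpath_self]
        exact aux _ _ rfl p.source
      exact aux' _ ht0
    | succ k ih =>
      obtain ⟨q, hq, hqH⟩ := ih
      obtain ⟨x, hx⟩ := htc k
      obtain ⟨q', hq', hq''⟩ := hNA x _ _ (p.subpath (t k) (t (k + 1)))
        (p.subpath_mem (htm k.le_succ) fun s h1 h2 ↦ hx ⟨h1, h2⟩)
      refine ⟨_, hq'', ?_⟩
      convert H.mul_mem (h_diff _ _ hq _ hq') hqH using 1
      rw [FundamentalGroup.mul_def, ← mk_subpath_trans p 0 (t k) (t (k + 1))]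
      have : ∀ (y z w : X) (hy : o = y) (a : Path.Homotopic.Quotient y z)
          (b : Path.Homotopic.Quotient z w) (q q' : Path.Homotopic.Quotient o z),
          ((a.trans b).cast hy rfl).trans (q'.trans b).symm =
            ((a.cast hy rfl).trans q.symm).trans (q.trans q'.symm) := by
        rintro y z w rfl a b q q'
        simp only [cast_rfl_rfl, symm_trans_rev, trans_assoc, trans_symm_cancel, symm_trans_cancel]
      exact this _ _ _ _ _ _ _ _
  -- At the end of `p`, the member of `A` is itself an element of `H`, as constant paths belong to `A`.
  -- The equalities of endpoints, which are not definitional, are generalized away.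
  obtain ⟨q, hq, hqH⟩ := key n
  have aux : ∀ s (hs : s = 1) (q : Path.Homotopic.Quotient o (p s)), q ∈ A (p s) →
      FundamentalGroup.fromPath
        (((mk (p.subpath 0 s)).cast p.source.symm rfl).trans q.symm) ∈ H →
      FundamentalGroup.fromPath (mk p) ∈ H := by
    rintro s rfl q hq hqH
    rw [Path.subpath_zero_one] at hqH
    have : ∀ (y z) (hy : y = o) (hz : z = o) (q : Path.Homotopic.Quotient o z), q ∈ A z →
        FundamentalGroup.fromPath
        (((mk (p.cast hy hz)).cast hy.symm rfl).trans q.symm) ∈ H →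
        FundamentalGroup.fromPath (mk p) ∈ H := by
      rintro y z rfl rfl q hq hqH
      convert H.mul_mem (h_diff _ _ hq _ h_one) hqH using 1
      rw [FundamentalGroup.mul_def]
      simp only [mk_cast, cast_rfl_rfl, trans_assoc]
      have h1 : ∀ y : X,
          (Path.Homotopic.Quotient.refl y).symm = Path.Homotopic.Quotient.refl y := fun _ ↦ rfl
      simp [h1]
    exact this _ _ p.source p.target q hq hqH
  exact aux _ (hn n le_rfl) q hq hqH

/-! ### A covering glued from two trivial pieces -/

section Clutching

variable {X G : Type*} [TopologicalSpace X] [Group G] [TopologicalSpace G] [DiscreteTopology G]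

/-- The principal bundle with discrete structure group `G` that is glued from the trivial bundles
over two open sets `U true` and `U false` by means of the transition function `g`, which has to be
continuous, that is, locally constant, on `U true ∩ U false`. The transition function from `false`
to `true` is `g`; it acts from the left, so that the structure group acts from the right. -/
noncomputable def clutchingBundle (U : Bool → Set X) (hU : ∀ b, IsOpen (U b))
    (hcover : ∀ x, x ∉ U true → x ∈ U false) (g : X → G)
    (hg : ContinuousOn g (U true ∩ U false)) : FiberBundleCore Bool X G where
  baseSet := U
  isOpen_baseSet := hU
  indexAt x := by classical exact decide (x ∈ U true)
  mem_baseSet_at x := by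
    by_cases hx : x ∈ U true
    · simp [hx]
    · simpa [hx] using hcover x hx
  coordChange i j x v := (bif j then g x else 1) * ((bif i then (g x)⁻¹ else 1) * v)
  coordChange_self i x _ v := by cases i <;> simp
  continuousOn_coordChange i j := by
    have h1 : ContinuousOn (fun p : X × G ↦ g p.1) ((U true ∩ U false) ×ˢ univ) :=
      hg.comp continuousOn_fst fun p hp ↦ hp.1
    cases i <;> cases j
    · simpa using continuousOn_snd
    · simp only [cond_true, cond_false, one_mul]
      rw [inter_comm]
      exact h1.mul continuousOn_snd
    · simp only [cond_true, cond_false, one_mul]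
      exact h1.inv.mul continuousOn_snd
    · simpa using continuousOn_snd
  coordChange_comp i j k x _ v := by cases j <;> simp

variable {U : Bool → Set X} {hU : ∀ b, IsOpen (U b)} {hcover : ∀ x, x ∉ U true → x ∈ U false}
  {g : X → G} {hg : ContinuousOn g (U true ∩ U false)}

theorem isCoveringMap_clutchingBundle :
    IsCoveringMap (clutchingBundle U hU hcover g hg).proj :=
  FiberBundle.isCoveringMap

variable (hU hcover hg) in
/-- The point of the fibre over `x` of the glued bundle that has the coordinate `v` in the chart
with index `i`. -/
noncomputable def clutchingPoint (i : Bool) (x : X) (v : G) :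
    (clutchingBundle U hU hcover g hg).proj ⁻¹' {x} :=
  ⟨((clutchingBundle U hU hcover g hg).localTriv i).toOpenPartialHomeomorph.symm (x, v), rfl⟩

theorem clutchingPoint_injective (i : Bool) (x : X) :
    Function.Injective (clutchingPoint hU hcover hg i x) := by
  intro v w h
  have h1 := congrArg Subtype.val h
  simp only [clutchingPoint, FiberBundleCore.localTriv_symm_apply] at h1
  have h2 := eq_of_heq (Bundle.TotalSpace.mk.inj h1).2
  exact mul_left_cancel (mul_left_cancel h2)

/-- The change of coordinates between the two charts. -/
theorem clutchingPoint_true (x : X) (v : G) :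
    clutchingPoint hU hcover hg true x (g x * v) = clutchingPoint hU hcover hg false x v := by
  apply Subtype.ext
  simp only [clutchingPoint, FiberBundleCore.localTriv_symm_apply]
  simp [clutchingBundle]

/-- Along a path inside one chart, the coordinate in this chart does not change. -/
theorem monodromy_clutchingPoint (i : Bool) {x y : X} (p : Path x y) (hp : ∀ t, p t ∈ U i) (v : G) :
    (isCoveringMap_clutchingBundle (hU := hU) (hcover := hcover) (hg := hg)).monodromy (mk p)
      (clutchingPoint hU hcover hg i x v) = clutchingPoint hU hcover hg i y v := by
  let Γ : Path (clutchingPoint hU hcover hg i x v).1 (clutchingPoint hU hcover hg i y v).1 :=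
    { toFun := fun t ↦ (clutchingPoint hU hcover hg i (p t) v).1
      continuous_toFun := by
        refine ((clutchingBundle U hU hcover g hg).localTriv i).continuousOn_invFun.comp_continuous
          (f := fun t ↦ (p t, v)) (by fun_prop) fun t ↦ ?_
        exact ⟨hp t, mem_univ _⟩
      source' := by rw [p.source]
      target' := by rw [p.target] }
  apply IsCoveringMap.monodromy_eq_of_map_eq _ (mk Γ)
  exact congrArg mk (Path.ext rfl)

end Clutching

/-! ### The complement of the two spheres and its radial loops -/

section Geometry

variable {m : ℕ}

theorem norm_eq_iff_sum_sq {n : ℕ} {x : Rn n} {r s : ℝ} (hr : 0 ≤ r) (hs : s = r ^ 2) :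
    ‖x‖ = r ↔ ∑ j, x j ^ 2 = s := by
  rw [hs, ← EuclideanSpace.real_norm_sq_eq, sq_eq_sq₀ (norm_nonneg _) hr]

theorem mem_knotK1 {x : Rn (m + 3)} :
    x ∈ knotK1 (m + 3) ↔ x (Fin.last _) = 0 ∧ ‖x‖ = 2 := by
  have h : ∀ j : Fin (m + 3), (j : ℕ) + 1 = m + 3 ↔ j = Fin.last _ := by
    intro j; rw [Fin.ext_iff, Fin.val_last]; omega
  have h' : ∀ j : Fin (m + 3), (j : ℕ) + 1 < m + 3 ↔ j ≠ Fin.last _ := by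
    intro j; rw [Ne, ← h]; omega
  simp only [knotK1, mem_ofPred_eq, h, h', forall_eq]
  rw [and_comm]
  refine and_congr_right fun h0 ↦ ?_
  rw [Finset.sum_filter_of_ne, norm_eq_iff_sum_sq zero_le_two (s := 4) (by norm_num)]
  rintro j - hj rfl
  simp [h0] at hj

theorem mem_knotK2 {x : Rn (m + 3)} :
    x ∈ knotK2 1 (m + 3) ↔ x 0 = 0 ∧ ‖x‖ = 3 := by
  have h : ∀ j : Fin (m + 3), (j : ℕ) < 1 ↔ j = 0 := by
    intro j; rw [Fin.ext_iff, Fin.val_zero]; omega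
  have h' : ∀ j : Fin (m + 3), 1 ≤ (j : ℕ) ↔ j ≠ 0 := by
    intro j; rw [Ne, ← h]; omega
  simp only [knotK2, mem_ofPred_eq, h, h', forall_eq]
  rw [and_comm]
  refine and_congr_right fun h0 ↦ ?_
  rw [Finset.sum_filter_of_ne, norm_eq_iff_sum_sq zero_le_three (s := 9) (by norm_num)]
  rintro j - hj rfl
  simp [h0] at hj

theorem mem_knotK3 {x : Rn (m + 3)} : x ∈ knotK3 1 (m + 3) ↔
    x 0 ^ 2 + x (Fin.last _) ^ 2 / 16 = 1 ∧ ∀ j, j ≠ 0 → j ≠ Fin.last _ → x j = 0 := by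
  have h : ∀ j : Fin (m + 3), (j : ℕ) + 1 = m + 3 ↔ j = Fin.last _ := by
    intro j; rw [Fin.ext_iff, Fin.val_last]; omega
  have h0 : ∀ j : Fin (m + 3), (j : ℕ) < 1 ↔ j = 0 := by
    intro j; rw [Fin.ext_iff, Fin.val_zero]; omega
  have h1 : ∀ j : Fin (m + 3), 1 ≤ (j : ℕ) ↔ j ≠ 0 := by
    intro j; rw [Ne, ← h0]; omega
  have h' : ∀ j : Fin (m + 3), (j : ℕ) + 1 < m + 3 ↔ j ≠ Fin.last _ := by
    intro j; rw [Ne, ← h]; omega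
  simp only [knotK3, mem_ofPred_eq, h, h', h0, h1]
  simp [Finset.sum_filter]

theorem notMem_knots_iff {x : Rn (m + 3)} : x ∉ knotK1 (m + 3) ∪ knotK2 1 (m + 3) ↔
    (x (Fin.last _) = 0 → ‖x‖ ≠ 2) ∧ (x 0 = 0 → ‖x‖ ≠ 3) := by
  rw [mem_union, mem_knotK1, mem_knotK2]; tauto

theorem planePoint_zero (a b : ℝ) : planePoint (m + 3) a b 0 = a := by
  simp [planePoint]

theorem planePoint_last (a b : ℝ) : planePoint (m + 3) a b (Fin.last _) = b := by
  simp [planePoint]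

theorem planePoint_of_ne (a b : ℝ) {j : Fin (m + 3)} (h0 : j ≠ 0) (h : j ≠ Fin.last _) :
    planePoint (m + 3) a b j = 0 := by
  have h1 : (j : ℕ) ≠ 0 := fun h' ↦ h0 (Fin.ext h')
  have h2 : (j : ℕ) + 1 ≠ m + 3 := fun h' ↦ h (Fin.ext (by simp; omega))
  simp only [planePoint, h1, h2, if_false]

theorem norm_sq_planePoint (a b : ℝ) : ‖planePoint (m + 3) a b‖ ^ 2 = a ^ 2 + b ^ 2 := by
  rw [EuclideanSpace.real_norm_sq_eq, Finset.sum_eq_add (0 : Fin (m + 3)) (Fin.last _)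
    (by simp [Fin.ext_iff]) (fun j _ hj ↦ by rw [planePoint_of_ne a b hj.1 hj.2]; norm_num)
    (by simp) (by simp), planePoint_zero, planePoint_last]

variable (m) in
/-- The points that can be joined to the origin by a segment that misses the two spheres: the space
minus the two closed sets `{xₙ = 0, ‖x‖ ≥ 2}` and `{x₁ = 0, ‖x‖ ≥ 3}`. -/
def starRegion : Set (Rn (m + 3)) :=
  {x | (x (Fin.last _) = 0 → ‖x‖ < 2) ∧ (x 0 = 0 → ‖x‖ < 3)}

theorem starRegion_subset {x : Rn (m + 3)} (hx : x ∈ starRegion m) :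
    x ∉ knotK1 (m + 3) ∪ knotK2 1 (m + 3) :=
  notMem_knots_iff.2 ⟨fun h ↦ (hx.1 h).ne, fun h ↦ (hx.2 h).ne⟩

theorem starConvex_starRegion : StarConvex ℝ 0 (starRegion m) := by
  rw [starConvex_zero_iff]
  intro x hx a ha0 ha1
  rcases ha0.eq_or_lt with rfl | ha
  · simp [starRegion]
  · have hle : ‖a • x‖ ≤ ‖x‖ := by
      rw [norm_smul, Real.norm_of_nonneg ha0]
      exact mul_le_of_le_one_left (norm_nonneg _) ha1
    refine ⟨fun h ↦ hle.trans_lt (hx.1 ?_), fun h ↦ hle.trans_lt (hx.2 ?_)⟩ <;>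
    simpa [ha.ne'] using h

variable (m) in
/-- The origin, as the base point of the complement. -/
def origin : complK1K2 (m + 3) :=
  ⟨0, starRegion_subset (by simp [starRegion])⟩

theorem origin_mem : (origin m : Rn (m + 3)) ∈ starRegion m := by simp [starRegion, origin]

/-- The radial path from the origin to a point of the star region. -/
noncomputable def ray (y : complK1K2 (m + 3)) (hy : (y : Rn (m + 3)) ∈ starRegion m) :
    Path (origin m) y :=
  segmentPath (origin m) y fun _ hz ↦ starRegion_subset (starConvex_starRegion.segment_subset hy hz)

theorem ray_mem (y : complK1K2 (m + 3)) (hy : (y : Rn (m + 3)) ∈ starRegion m) (t : I) :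
    (ray y hy t : Rn (m + 3)) ∈ starRegion m := by
  have h := segmentPath_mem (origin m) y (fun _ hz ↦
    starRegion_subset (starConvex_starRegion.segment_subset hy hz)) t
  exact starConvex_starRegion.segment_subset hy h

/-- The loop at the origin obtained from a path between two points of the star region by attaching
the radial paths to its endpoints. -/
noncomputable def radialLoop {w u : complK1K2 (m + 3)} (c : Path.Homotopic.Quotient w u)
    (hw : (w : Rn (m + 3)) ∈ starRegion m) (hu : (u : Rn (m + 3)) ∈ starRegion m) :
    Path.Homotopic.Quotient (origin m) (origin m) :=
  ((mk (ray w hw)).trans c).trans (mk (ray u hu)).symm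

variable {u v w : complK1K2 (m + 3)} {hu : (u : Rn (m + 3)) ∈ starRegion m}
  {hv : (v : Rn (m + 3)) ∈ starRegion m} {hw : (w : Rn (m + 3)) ∈ starRegion m}

theorem radialLoop_trans (hv : (v : Rn (m + 3)) ∈ starRegion m) (c : Path.Homotopic.Quotient w v)
    (d : Path.Homotopic.Quotient v u) :
    radialLoop (c.trans d) hw hu = (radialLoop c hw hv).trans (radialLoop d hv hu) := by
  simp only [radialLoop, trans_assoc, symm_trans_cancel]

theorem radialLoop_symm (c : Path.Homotopic.Quotient w v) :
    radialLoop c.symm hv hw = (radialLoop c hw hv).symm := by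
  simp only [radialLoop, symm_trans_rev, symm_symm, trans_assoc]

/-- Paths that stay in the star region give trivial loops. -/
theorem radialLoop_of_mem (p : Path w u) (hp : ∀ t, (p t : Rn (m + 3)) ∈ starRegion m) :
    radialLoop (mk p) hw hu = .refl _ := by
  have : mk ((ray w hw).trans p) = mk (ray u hu) := by
    refine Path.Homotopic.Quotient.eq.2 (homotopic_of_starConvex starConvex_starRegion
      (fun _ ↦ starRegion_subset) _ _ (fun t ↦ ?_) (ray_mem u hu))
    rw [Path.trans_apply]
    split_ifs
    exacts [ray_mem _ _ _, hp _]
  rw [radialLoop, ← mk_trans, this, trans_symm]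

theorem radialLoop_origin (c : Path.Homotopic.Quotient (origin m) (origin m)) :
    radialLoop c origin_mem origin_mem = c := by
  have : mk (ray (origin m) origin_mem) = .refl _ :=
    Path.Homotopic.Quotient.eq.2 (homotopic_of_starConvex starConvex_starRegion
      (fun _ ↦ starRegion_subset) _ _ (ray_mem _ _) fun _ ↦ origin_mem)
  rw [radialLoop, this, refl_trans]
  exact trans_refl c

theorem radialLoop_subpath_zero_one (p : Path w u) :
    radialLoop (mk (p.subpath 0 1)) (by simpa using hw) (by simpa using hu) =
      radialLoop (mk p) hw hu := by
  have : ∀ (x y : complK1K2 (m + 3)) (hx : x = w) (hy : y = u)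
      (hx' : (x : Rn (m + 3)) ∈ starRegion m) (hy' : (y : Rn (m + 3)) ∈ starRegion m),
      radialLoop (mk (p.cast hx hy)) hx' hy' = radialLoop (mk p) hw hu := by
    rintro x y rfl rfl hx' hy'; rfl
  rw [Path.subpath_zero_one]
  exact this _ _ _ _ _ _

end Geometry

/-! ### Moving radial loops along half-spaces -/

section ConvexPaths

theorem Path.trans_mem {X : Type*} [TopologicalSpace X] {S : Set X} {x y z : X} {p : Path x y}
    {q : Path y z} (hp : ∀ t, p t ∈ S) (hq : ∀ t, q t ∈ S) (t : I) : p.trans q t ∈ S := by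
  rw [Path.trans_apply]
  split_ifs
  exacts [hp _, hq _]

theorem Path.trans_coe_mem {E : Type*} [TopologicalSpace E] {P : E → Prop} {N : Set E}
    {x y z : {z : E // P z}} {p : Path x y} {q : Path y z}
    (hp : ∀ t, (p t : E) ∈ N) (hq : ∀ t, (q t : E) ∈ N) (t : I) :
    (p.trans q t : E) ∈ N :=
  Path.trans_mem (S := Subtype.val ⁻¹' N) hp hq t

variable {E : Type*} [AddCommGroup E] [Module ℝ E] [TopologicalSpace E] [IsTopologicalAddGroup E]
  [ContinuousSMul ℝ E] {P : E → Prop} {N : Set E}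

theorem Path.subpath_coe_mem {E : Type*} [TopologicalSpace E] {P : E → Prop} {N : Set E}
    {x y : {z : E // P z}} (p : Path x y) {r s : I} (hrs : r ≤ s)
    (h : ∀ t, r ≤ t → t ≤ s → (p t : E) ∈ N) (t : I) : (p.subpath r s t : E) ∈ N :=
  p.subpath_mem (S := Subtype.val ⁻¹' N) hrs h t

/-- In a convex set, paths with the same endpoints are homotopic. -/
theorem mk_eq_of_convex (hN : Convex ℝ N) (hNP : ∀ z ∈ N, P z) {x y : {z : E // P z}}
    {p q : Path x y} (hp : ∀ t, (p t : E) ∈ N) (hq : ∀ t, (q t : E) ∈ N) : mk p = mk q :=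
  Path.Homotopic.Quotient.eq.2
    (homotopic_of_starConvex (hN.starConvex (hp 0)) hNP p q hp hq)

/-- Any two points of a convex set are joined in it by a straight path. -/
theorem exists_path_of_convex (hN : Convex ℝ N) (hNP : ∀ z ∈ N, P z) {x y : {z : E // P z}}
    (hx : (x : E) ∈ N) (hy : (y : E) ∈ N) :
    ∃ p : Path x y, ∀ t, (p t : E) ∈ segment ℝ (x : E) y ∧ (p t : E) ∈ N :=
  have h := hN.segment_subset hx hy
  ⟨segmentPath x y fun z hz ↦ hNP z (h hz), fun t ↦
    ⟨segmentPath_mem x y _ t, h (segmentPath_mem x y _ t)⟩⟩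

end ConvexPaths

section Crossing

variable {m : ℕ}

/-- The two spheres in a uniform notation: the sphere of radius `a` in the hyperplane `x i = 0` is
one of them, and the other one lies in the hyperplane `x j = 0`. -/
def IsSphereData (i j : Fin (m + 3)) (a : ℝ) : Prop :=
  (i = 0 ∧ j = Fin.last _ ∧ a = 3) ∨ (i = Fin.last _ ∧ j = 0 ∧ a = 2)

variable {i j : Fin (m + 3)} {a ε : ℝ}

theorem IsSphereData.ne (h : IsSphereData i j a) : i ≠ j := by
  rcases h with ⟨rfl, rfl, -⟩ | ⟨rfl, rfl, -⟩ <;> simp [Fin.ext_iff]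

theorem IsSphereData.pos (h : IsSphereData i j a) : 0 < a := by
  rcases h with ⟨-, -, rfl⟩ | ⟨-, -, rfl⟩ <;> norm_num

theorem IsSphereData.notMem (h : IsSphereData i j a) {x : Rn (m + 3)} (hj : x j ≠ 0)
    (hi : x i = 0 → ‖x‖ ≠ a) : x ∉ knotK1 (m + 3) ∪ knotK2 1 (m + 3) := by
  rw [notMem_knots_iff]
  rcases h with ⟨rfl, rfl, rfl⟩ | ⟨rfl, rfl, rfl⟩
  exacts [⟨fun h ↦ absurd h hj, hi⟩, ⟨hi, fun h ↦ absurd h hj⟩]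

theorem IsSphereData.norm_ne (h : IsSphereData i j a) {x : Rn (m + 3)}
    (hx : x ∉ knotK1 (m + 3) ∪ knotK2 1 (m + 3)) : x i = 0 → ‖x‖ ≠ a := by
  rw [notMem_knots_iff] at hx
  rcases h with ⟨rfl, rfl, rfl⟩ | ⟨rfl, rfl, rfl⟩
  exacts [hx.2, hx.1]

theorem IsSphereData.mem_starRegion (h : IsSphereData i j a) {x : Rn (m + 3)} (hj : x j ≠ 0)
    (hi : x i = 0 → ‖x‖ < a) : x ∈ starRegion m := by
  rcases h with ⟨rfl, rfl, rfl⟩ | ⟨rfl, rfl, rfl⟩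
  exacts [⟨fun h ↦ absurd h hj, hi⟩, ⟨hi, fun h ↦ absurd h hj⟩]

/-- A convex set on one side of the hyperplane `x j = 0` whose points in the hyperplane `x i = 0`
lie outside of the sphere of radius `a`. -/
structure IsOuter (i j : Fin (m + 3)) (a ε : ℝ) (M : Set (Rn (m + 3))) : Prop where
  convex : Convex ℝ M
  side : ∀ x ∈ M, 0 < ε * x j
  lt_norm : ∀ x ∈ M, x i = 0 → a < ‖x‖

theorem IsOuter.ne_zero {M : Set (Rn (m + 3))} (hM : IsOuter i j a ε M) {x : Rn (m + 3)}
    (hx : x ∈ M) : x j ≠ 0 := fun h ↦ by simpa [h] using hM.side x hx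

theorem convex_setOf_lt_coord (i : Fin (m + 3)) (a s : ℝ) :
    Convex ℝ {x : Rn (m + 3) | a < s * x i} :=
  convex_halfSpace_gt (𝕜 := ℝ) (f := fun x : Rn (m + 3) ↦ s * x i)
    ⟨fun x y ↦ by simp [mul_add], fun c x ↦ by simp; ring⟩ a

theorem isOuter_halfSpace (h : IsSphereData i j a) (hε : ε ^ 2 = 1) :
    IsOuter i j a ε {x : Rn (m + 3) | a < ε * x j} where
  convex := convex_setOf_lt_coord j a ε
  side x hx := h.pos.trans hx
  lt_norm x hx _ := by
    have h1 : |ε| = 1 := by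
      rw [← abs_one]; exact sq_eq_sq_iff_abs_eq_abs _ _ |>.1 (by rw [hε, one_pow])
    calc a < ε * x j := hx
      _ ≤ |ε * x j| := le_abs_self _
      _ = ‖x j‖ := by rw [abs_mul, h1, one_mul, Real.norm_eq_abs]
      _ ≤ ‖x‖ := PiLp.norm_apply_le x j

/-- The union of the translates of an outer set in the direction away from the hyperplane
`x j = 0` is an outer set. -/
theorem IsOuter.add_ray {M : Set (Rn (m + 3))} (hM : IsOuter i j a ε M) (h : IsSphereData i j a)
    (hε : ε ^ 2 = 1) :
    IsOuter i j a ε (M + (fun s : ℝ ↦ s • EuclideanSpace.single j ε) '' Ici 0) where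
  convex := hM.convex.add ((convex_Ici 0).is_linear_image
    ⟨fun x y ↦ add_smul _ _ _, fun c x ↦ by simp [mul_smul]⟩)
  side := by
    rintro _ ⟨y, hy, _, ⟨s, hs, rfl⟩, rfl⟩
    have h1 := hM.side y hy
    have h2 : ε * (y j + s * ε) = ε * y j + s := by linear_combination s * hε
    have hs : 0 ≤ s := hs
    simp only [PiLp.add_apply, PiLp.smul_apply, PiLp.single_apply, if_true, smul_eq_mul]
    linarith
  lt_norm := by
    rintro _ ⟨y, hy, _, ⟨s, hs, rfl⟩, rfl⟩ hi
    have hs : 0 ≤ s := hs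
    simp only [PiLp.add_apply, PiLp.smul_apply, PiLp.single_apply, h.ne, if_false,
      smul_eq_mul, mul_zero, add_zero] at hi
    refine (hM.lt_norm y hy hi).trans_le (le_of_sq_le_sq ?_ (norm_nonneg _))
    have h1 : inner ℝ y (s • EuclideanSpace.single j ε) = s * (ε * y j) := by
      rw [inner_smul_right, EuclideanSpace.inner_single_right]; simp
    dsimp only
    rw [norm_add_sq_real, h1]
    have := mul_nonneg hs (hM.side y hy).le
    linarith [sq_nonneg ‖s • EuclideanSpace.single j ε‖]

variable {u v w u' w' : complK1K2 (m + 3)} {hu : (u : Rn (m + 3)) ∈ starRegion m}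
  {hv : (v : Rn (m + 3)) ∈ starRegion m} {hw : (w : Rn (m + 3)) ∈ starRegion m}
  {hu' : (u' : Rn (m + 3)) ∈ starRegion m} {hw' : (w' : Rn (m + 3)) ∈ starRegion m}

theorem IsOuter.notMem {M : Set (Rn (m + 3))} (hM : IsOuter i j a ε M) (h : IsSphereData i j a) :
    ∀ x ∈ M, x ∉ knotK1 (m + 3) ∪ knotK2 1 (m + 3) := fun x hx ↦
  h.notMem (hM.ne_zero hx) fun hi ↦ (hM.lt_norm x hx hi).ne'

/-- A path in a convex set of the complement whose endpoints lie on the same side of the hyperplane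
`x i = 0` and which stays on one side of `x j = 0` gives a trivial loop. -/
theorem radialLoop_eq_refl (h : IsSphereData i j a) {N : Set (Rn (m + 3))} (hN : Convex ℝ N)
    (hNP : ∀ z ∈ N, z ∉ knotK1 (m + 3) ∪ knotK2 1 (m + 3)) (c : Path w u)
    (hc : ∀ t, (c t : Rn (m + 3)) ∈ N) (hj : 0 < ε * w.1 j) (hj' : 0 < ε * u.1 j)
    (hi : 0 < w.1 i * u.1 i) : radialLoop (mk c) hw hu = .refl _ := by
  have hwN : (w : Rn (m + 3)) ∈ N := by simpa using hc 0
  have huN : (u : Rn (m + 3)) ∈ N := by simpa using hc 1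
  obtain ⟨p, hp⟩ := exists_path_of_convex hN hNP hwN huN
  rw [mk_eq_of_convex hN hNP hc fun t ↦ (hp t).2]
  refine radialLoop_of_mem p fun t ↦ ?_
  have h1 := (convex_setOf_lt_coord j 0 ε).segment_subset hj hj' (hp t).1
  have h2 := (convex_setOf_lt_coord i 0 (w.1 i)).segment_subset
    (mul_self_pos.2 (left_ne_zero_of_mul hi.ne')) hi (hp t).1
  exact h.mem_starRegion (fun h0 ↦ by simp [h0] at h1) fun h0 ↦ by simp [h0] at h2

/-- A path in an outer set can be translated away from the hyperplane `x j = 0` into the half-space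
beyond the distance `a` from it: the connecting segments give trivial loops. -/
theorem radialLoop_eq_of_translate (h : IsSphereData i j a) (hε : ε ^ 2 = 1)
    {M : Set (Rn (m + 3))} (hM : IsOuter i j a ε M) (c : Path w u)
    (hc : ∀ t, (c t : Rn (m + 3)) ∈ M) (hwi : w.1 i ≠ 0) (hui : u.1 i ≠ 0)
    (hw₁ : w'.1 = w.1 + a • EuclideanSpace.single j ε)
    (hu₁ : u'.1 = u.1 + a • EuclideanSpace.single j ε)
    (d : Path w' u') (hd : ∀ t, a < ε * (d t : Rn (m + 3)) j) :
    radialLoop (mk c) hw hu = radialLoop (mk d) hw' hu' := by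
  have hM' := hM.add_ray h hε
  set M' := M + (fun s : ℝ ↦ s • EuclideanSpace.single j ε) '' Ici 0
  have hT := isOuter_halfSpace (m := m) h hε
  have hMM : M ⊆ M' := fun x hx ↦ ⟨x, hx, 0, ⟨0, self_mem_Ici, by simp⟩, by simp⟩
  have hMa : ∀ x ∈ M, x + a • EuclideanSpace.single j ε ∈ M' :=
    fun x hx ↦ ⟨x, hx, _, ⟨a, h.pos.le, rfl⟩, rfl⟩
  have hcoord : ∀ x : Rn (m + 3), (x + a • EuclideanSpace.single j ε) i = x i := by
    intro x; simp [h.ne]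
  have hwM : (w : Rn (m + 3)) ∈ M := by simpa using hc 0
  have huM : (u : Rn (m + 3)) ∈ M := by simpa using hc 1
  have hwM' : (w' : Rn (m + 3)) ∈ M' := hw₁ ▸ hMa _ hwM
  have huM' : (u' : Rn (m + 3)) ∈ M' := hu₁ ▸ hMa _ huM
  obtain ⟨a₁, ha₁⟩ := exists_path_of_convex hM'.convex (hM'.notMem h) (hMM hwM) hwM'
  obtain ⟨a₂, ha₂⟩ := exists_path_of_convex hM'.convex (hM'.notMem h) hwM' huM'
  obtain ⟨a₃, ha₃⟩ := exists_path_of_convex hM'.convex (hM'.notMem h) huM' (hMM huM)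
  have e1 : mk c = mk ((a₁.trans a₂).trans a₃) :=
    mk_eq_of_convex hM'.convex (hM'.notMem h) (fun t ↦ hMM (hc t))
      (Path.trans_coe_mem (Path.trans_coe_mem (fun t ↦ (ha₁ t).2) fun t ↦ (ha₂ t).2)
        fun t ↦ (ha₃ t).2)
  have e2 : mk a₂ = mk d := by
    refine mk_eq_of_convex hT.convex (hT.notMem h) (fun t ↦ ?_) hd
    refine hT.convex.segment_subset ?_ ?_ (ha₂ t).1
    · simpa using hd 0
    · simpa using hd 1
  have t1 : radialLoop (mk a₁) hw hw' = .refl _ :=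
    radialLoop_eq_refl h hM'.convex (hM'.notMem h) a₁ (fun t ↦ (ha₁ t).2) (hM.side _ hwM)
      (hM'.side _ hwM') (by rw [hw₁, hcoord]; exact mul_self_pos.2 hwi)
  have t3 : radialLoop (mk a₃) hu' hu = .refl _ :=
    radialLoop_eq_refl h hM'.convex (hM'.notMem h) a₃ (fun t ↦ (ha₃ t).2) (hM'.side _ huM')
      (hM.side _ huM) (by rw [hu₁, hcoord]; exact mul_self_pos.2 hui)
  rw [e1, mk_trans, mk_trans, radialLoop_trans hu', radialLoop_trans hw', t1, t3, e2, refl_trans]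
  exact trans_refl _

/-- The loop given by a path that crosses the hyperplane `x i = 0` outside of the sphere of radius
`a` depends only on the side of the hyperplane `x j = 0` where this happens, and on the direction of
the crossing. -/
theorem radialLoop_eq_of_isOuter (h : IsSphereData i j a) (hε : ε ^ 2 = 1)
    {M M' : Set (Rn (m + 3))} (hM : IsOuter i j a ε M) (hM' : IsOuter i j a ε M')
    (c : Path w u) (hc : ∀ t, (c t : Rn (m + 3)) ∈ M)
    (d : Path w' u') (hd : ∀ t, (d t : Rn (m + 3)) ∈ M')
    (hwi : 0 < w.1 i * w'.1 i) (hui : 0 < u.1 i * u'.1 i) :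
    radialLoop (mk c) hw hu = radialLoop (mk d) hw' hu' := by
  have hT := isOuter_halfSpace (m := m) h hε
  set T := {x : Rn (m + 3) | a < ε * x j}
  have hTa : ∀ x : Rn (m + 3), 0 < ε * x j → x + a • EuclideanSpace.single j ε ∈ T := by
    intro x hx
    have h2 : ε * (x j + a * ε) = ε * x j + a := by linear_combination a * hε
    change a < ε * (x + a • EuclideanSpace.single j ε) j
    simp only [PiLp.add_apply, PiLp.smul_apply, PiLp.single_apply, if_true, smul_eq_mul]
    linarith
  have hcoord : ∀ x : Rn (m + 3), (x + a • EuclideanSpace.single j ε) i = x i := by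
    intro x; simp [h.ne]
  have hwM : (w : Rn (m + 3)) ∈ M := by simpa using hc 0
  have huM : (u : Rn (m + 3)) ∈ M := by simpa using hc 1
  have hwM' : (w' : Rn (m + 3)) ∈ M' := by simpa using hd 0
  have huM' : (u' : Rn (m + 3)) ∈ M' := by simpa using hd 1
  have key : ∀ x : complK1K2 (m + 3), 0 < ε * x.1 j → x.1 i ≠ 0 → ∃ y : complK1K2 (m + 3),
      y.1 = x.1 + a • EuclideanSpace.single j ε ∧ y.1 ∈ T ∧ y.1 ∈ starRegion m := by
    intro x hx hi
    have h1 := hTa x hx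
    exact ⟨⟨_, hT.notMem h _ h1⟩, rfl, h1, h.mem_starRegion (hT.ne_zero h1) fun h0 ↦
      absurd ((hcoord _).symm.trans h0) hi⟩
  have hwi1 := left_ne_zero_of_mul hwi.ne'
  have hwi2 := right_ne_zero_of_mul hwi.ne'
  have hui1 := left_ne_zero_of_mul hui.ne'
  have hui2 := right_ne_zero_of_mul hui.ne'
  obtain ⟨w₁, hw₁, hw₁T, hw₁S⟩ := key w (hM.side _ hwM) hwi1
  obtain ⟨u₁, hu₁, hu₁T, hu₁S⟩ := key u (hM.side _ huM) hui1
  obtain ⟨w₂, hw₂, hw₂T, hw₂S⟩ := key w' (hM'.side _ hwM') hwi2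
  obtain ⟨u₂, hu₂, hu₂T, hu₂S⟩ := key u' (hM'.side _ huM') hui2
  obtain ⟨b₁, hb₁⟩ := exists_path_of_convex hT.convex (hT.notMem h) hw₁T hw₂T
  obtain ⟨b₂, hb₂⟩ := exists_path_of_convex hT.convex (hT.notMem h) hw₂T hu₂T
  obtain ⟨b₃, hb₃⟩ := exists_path_of_convex hT.convex (hT.notMem h) hu₂T hu₁T
  have t1 : radialLoop (mk b₁) hw₁S hw₂S = .refl _ :=
    radialLoop_eq_refl h hT.convex (hT.notMem h) b₁ (fun t ↦ (hb₁ t).2) (hT.side _ hw₁T)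
      (hT.side _ hw₂T) (by rw [hw₁, hw₂, hcoord, hcoord]; exact hwi)
  have t3 : radialLoop (mk b₃) hu₂S hu₁S = .refl _ :=
    radialLoop_eq_refl h hT.convex (hT.notMem h) b₃ (fun t ↦ (hb₃ t).2) (hT.side _ hu₂T)
      (hT.side _ hu₁T) (by rw [hu₁, hu₂, hcoord, hcoord, mul_comm]; exact hui)
  rw [radialLoop_eq_of_translate h hε hM c hc hwi1 hui1 hw₁ hu₁ ((b₁.trans b₂).trans b₃)
      (hw' := hw₁S) (hu' := hu₁S)
      (Path.trans_coe_mem (N := T) (Path.trans_coe_mem (N := T) (fun t ↦ (hb₁ t).2)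
        fun t ↦ (hb₂ t).2) fun t ↦ (hb₃ t).2),
    radialLoop_eq_of_translate h hε hM' d hd hwi2 hui2 hw₂ hu₂ b₂ (hw' := hw₂S) (hu' := hu₂S)
      (fun t ↦ (hb₂ t).2),
    mk_trans, mk_trans, radialLoop_trans hu₂S, radialLoop_trans hw₂S, t1, t3, refl_trans]
  exact trans_refl _

end Crossing

/-! ### The loops of the theorem -/

section Loops

theorem cos_neg_of_mem_middle {t : ℝ} (h1 : 1 / 3 ≤ t) (h2 : t ≤ 2 / 3) :
    Real.cos (2 * Real.pi * t) < 0 := by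
  have := Real.pi_pos
  exact Real.cos_neg_of_pi_div_two_lt_of_lt (by nlinarith) (by nlinarith)

theorem cos_pos_of_le {t : ℝ} (h1 : 0 ≤ t) (h2 : t ≤ 1 / 6) : 0 < Real.cos (2 * Real.pi * t) := by
  have := Real.pi_pos
  exact Real.cos_pos_of_mem_Ioo ⟨by nlinarith, by nlinarith⟩

theorem cos_two_pi_mul_one_sub (t : ℝ) :
    Real.cos (2 * Real.pi * (1 - t)) = Real.cos (2 * Real.pi * t) := by
  rw [← Real.cos_two_pi_sub (2 * Real.pi * t)]; ring_nf

theorem cos_pos_of_ge {t : ℝ} (h1 : 5 / 6 ≤ t) (h2 : t ≤ 1) : 0 < Real.cos (2 * Real.pi * t) := by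
  rw [← cos_two_pi_mul_one_sub]
  exact cos_pos_of_le (by linarith) (by linarith)

theorem neg_one_lt_cos_of_le {t : ℝ} (h1 : 0 ≤ t) (h2 : t ≤ 1 / 3) :
    -1 < Real.cos (2 * Real.pi * t) := by
  have := Real.pi_pos
  rw [← Real.cos_pi]
  exact Real.cos_lt_cos_of_nonneg_of_le_pi (by positivity) le_rfl (by nlinarith)

theorem neg_one_lt_cos_of_ge {t : ℝ} (h1 : 2 / 3 ≤ t) (h2 : t ≤ 1) :
    -1 < Real.cos (2 * Real.pi * t) := by
  rw [← cos_two_pi_mul_one_sub]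
  exact neg_one_lt_cos_of_le (by linarith) (by linarith)

theorem three_quarters_lt_sin {t : ℝ} (h1 : 1 / 6 ≤ t) (h2 : t ≤ 1 / 3) :
    3 / 4 < Real.sin (2 * Real.pi * t) := by
  have := Real.pi_pos
  have hs : 0 < Real.sin (2 * Real.pi * t) :=
    Real.sin_pos_of_pos_of_lt_pi (by nlinarith) (by nlinarith)
  have hc : Real.cos (2 * Real.pi * t) ≤ 1 / 2 := by
    rw [← Real.cos_pi_div_three]
    exact Real.cos_le_cos_of_nonneg_of_le_pi (by positivity) (by nlinarith) (by nlinarith)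
  have hc' : -(1 / 2) ≤ Real.cos (2 * Real.pi * t) := by
    rw [← Real.cos_pi_div_three, ← Real.cos_pi_sub]
    exact Real.cos_le_cos_of_nonneg_of_le_pi (by nlinarith) (by linarith) (by nlinarith)
  have := Real.sin_sq_add_cos_sq (2 * Real.pi * t)
  nlinarith

theorem sin_two_pi_mul_one_sub (t : ℝ) :
    Real.sin (2 * Real.pi * (1 - t)) = -Real.sin (2 * Real.pi * t) := by
  rw [← Real.sin_two_pi_sub (2 * Real.pi * t)]; ring_nf

theorem sin_lt_neg_three_quarters {t : ℝ} (h1 : 2 / 3 ≤ t) (h2 : t ≤ 5 / 6) :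
    Real.sin (2 * Real.pi * t) < -(3 / 4) := by
  have := three_quarters_lt_sin (t := 1 - t) (by linarith) (by linarith)
  rw [sin_two_pi_mul_one_sub] at this
  linarith

variable {m : ℕ}

theorem continuous_planePoint {X : Type*} [TopologicalSpace X] {f g : X → ℝ} (hf : Continuous f)
    (hg : Continuous g) : Continuous fun t ↦ planePoint (m + 3) (f t) (g t) := by
  refine (PiLp.continuous_toLp 2 _).comp (continuous_pi fun j ↦ ?_)
  split_ifs
  exacts [hf, hg, continuous_const]

theorem planePoint_notMem {a b : ℝ} (h1 : b = 0 → a ^ 2 ≠ 4) (h2 : a = 0 → b ^ 2 ≠ 9) :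
    planePoint (m + 3) a b ∉ knotK1 (m + 3) ∪ knotK2 1 (m + 3) := by
  have h := norm_sq_planePoint (m := m) a b
  rw [notMem_knots_iff, planePoint_zero, planePoint_last]
  refine ⟨fun h0 hn ↦ h1 h0 ?_, fun h0 hn ↦ h2 h0 ?_⟩ <;> rw [hn, h0] at h <;> linarith

theorem planePoint_mem_starRegion {a b : ℝ} (h1 : b = 0 → a ^ 2 < 4) (h2 : a = 0 → b ^ 2 < 9) :
    planePoint (m + 3) a b ∈ starRegion m := by
  have h := norm_sq_planePoint (m := m) a b
  rw [starRegion, mem_ofPred_eq, planePoint_zero, planePoint_last]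
  refine ⟨fun h0 ↦ lt_of_pow_lt_pow_left₀ 2 (by norm_num) ?_,
    fun h0 ↦ lt_of_pow_lt_pow_left₀ 2 (by norm_num) ?_⟩
  · have := h1 h0; rw [h, h0]; linarith
  · have := h2 h0; rw [h, h0]; linarith

/-- The path `t ↦ (f t, 0, …, 0, g t)`. -/
noncomputable def planePath {x y : complK1K2 (m + 3)} (f g : ℝ → ℝ) (hf : Continuous f)
    (hg : Continuous g) (h1 : ∀ t ∈ I, g t = 0 → f t ^ 2 ≠ 4) (h2 : ∀ t ∈ I, f t = 0 → g t ^ 2 ≠ 9)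
    (hx : planePoint (m + 3) (f 0) (g 0) = x) (hy : planePoint (m + 3) (f 1) (g 1) = y) :
    Path x y where
  toFun t := ⟨planePoint (m + 3) (f t) (g t), planePoint_notMem (h1 t t.2) (h2 t t.2)⟩
  continuous_toFun := Continuous.subtype_mk
    (continuous_planePoint (hf.comp continuous_subtype_val) (hg.comp continuous_subtype_val)) _
  source' := Subtype.ext hx
  target' := Subtype.ext hy

theorem planePoint_zero_zero : planePoint (m + 3) 0 0 = 0 := by
  rw [← norm_eq_zero, ← sq_eq_zero_iff, norm_sq_planePoint]; norm_num

variable (m) in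
/-- The loop `α`: a circle of radius `3` that passes from the origin through the quadrant
`x₁, xₙ > 0` to the point `(0, …, 0, 6)` above the sphere `K₂`, and back through `x₁ < 0`. -/
noncomputable def alphaLoop : Path (origin m) (origin m) :=
  planePath (fun t ↦ 3 * Real.sin (2 * Real.pi * t)) (fun t ↦ 3 - 3 * Real.cos (2 * Real.pi * t))
    (by fun_prop) (by fun_prop)
    (fun t _ h1 h2 ↦ by nlinarith [Real.sin_sq_add_cos_sq (2 * Real.pi * t)])
    (fun t _ h1 h2 ↦ by nlinarith [Real.sin_sq_add_cos_sq (2 * Real.pi * t)])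
    (by simpa using! planePoint_zero_zero)
    (by simpa using! planePoint_zero_zero)

variable (m) in
/-- The loop `β`: a circle of radius `2` that passes from the origin through the quadrant
`x₁, xₙ > 0` to the point `(4, 0, …, 0)` outside of `K₁`, and back through `xₙ < 0`. -/
noncomputable def betaLoop : Path (origin m) (origin m) :=
  planePath (fun t ↦ 2 - 2 * Real.cos (2 * Real.pi * t)) (fun t ↦ 2 * Real.sin (2 * Real.pi * t))
    (by fun_prop) (by fun_prop)
    (fun t _ h1 h2 ↦ by nlinarith [Real.sin_sq_add_cos_sq (2 * Real.pi * t)])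
    (fun t _ h1 h2 ↦ by nlinarith [Real.sin_sq_add_cos_sq (2 * Real.pi * t)])
    (by simpa using! planePoint_zero_zero)
    (by simpa using! planePoint_zero_zero)

variable (m) in
/-- The vertex `(1, 0, …, 0)` of the ellipse. -/
noncomputable def vertex : complK1K2 (m + 3) :=
  ⟨planePoint (m + 3) 1 0, planePoint_notMem (by norm_num) (by norm_num)⟩

theorem vertex_mem : (vertex m : Rn (m + 3)) ∈ starRegion m :=
  planePoint_mem_starRegion (by norm_num) (by norm_num)

variable (m) in
/-- The segment `γ` from the origin to the vertex of the ellipse. -/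
noncomputable def gammaPath : Path (origin m) (vertex m) :=
  planePath (fun t ↦ t) (fun _ ↦ 0) (by fun_prop) (by fun_prop)
    (fun t ht _ h2 ↦ by nlinarith [ht.1, ht.2]) (fun t _ _ h ↦ by norm_num at h)
    planePoint_zero_zero rfl

variable (m) in
/-- The parametrized ellipse `κ`. -/
noncomputable def kappaLoop : Path (vertex m) (vertex m) :=
  planePath (fun t ↦ Real.cos (2 * Real.pi * t)) (fun t ↦ 4 * Real.sin (2 * Real.pi * t))
    (by fun_prop) (by fun_prop)
    (fun t _ h1 h2 ↦ by nlinarith [Real.sin_sq_add_cos_sq (2 * Real.pi * t)])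
    (fun t _ h1 h2 ↦ by nlinarith [Real.sin_sq_add_cos_sq (2 * Real.pi * t)])
    (by simp [vertex]) (by simp [vertex])

theorem alphaLoop_apply (t : I) : (alphaLoop m t : Rn (m + 3)) = planePoint (m + 3)
    (3 * Real.sin (2 * Real.pi * t)) (3 - 3 * Real.cos (2 * Real.pi * t)) := rfl

theorem betaLoop_apply (t : I) : (betaLoop m t : Rn (m + 3)) = planePoint (m + 3)
    (2 - 2 * Real.cos (2 * Real.pi * t)) (2 * Real.sin (2 * Real.pi * t)) := rfl

theorem gammaPath_apply (t : I) : (gammaPath m t : Rn (m + 3)) = planePoint (m + 3) t 0 := rfl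

theorem kappaLoop_apply (t : I) : (kappaLoop m t : Rn (m + 3)) = planePoint (m + 3)
    (Real.cos (2 * Real.pi * t)) (4 * Real.sin (2 * Real.pi * t)) := rfl

theorem alphaLoop_mem {t : I} (h : -1 < Real.cos (2 * Real.pi * t)) :
    (alphaLoop m t : Rn (m + 3)) ∈ starRegion m := by
  have hsc := Real.sin_sq_add_cos_sq (2 * Real.pi * t)
  rw [alphaLoop_apply]
  refine planePoint_mem_starRegion (fun h0 ↦ by nlinarith) fun h0 ↦ ?_
  have hs : Real.sin (2 * Real.pi * t) = 0 := by linarith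
  have : Real.cos (2 * Real.pi * t) = 1 := by
    have : (Real.cos (2 * Real.pi * t) + 1) * (Real.cos (2 * Real.pi * t) - 1) = 0 := by
      rw [hs] at hsc; linarith
    rcases mul_eq_zero.1 this with h' | h' <;> linarith
  rw [this]; norm_num

theorem betaLoop_mem {t : I} (h : -1 < Real.cos (2 * Real.pi * t)) :
    (betaLoop m t : Rn (m + 3)) ∈ starRegion m := by
  have hsc := Real.sin_sq_add_cos_sq (2 * Real.pi * t)
  rw [betaLoop_apply]
  refine planePoint_mem_starRegion (fun h0 ↦ ?_) fun h0 ↦ by nlinarith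
  have hs : Real.sin (2 * Real.pi * t) = 0 := by linarith
  have : Real.cos (2 * Real.pi * t) = 1 := by
    have : (Real.cos (2 * Real.pi * t) + 1) * (Real.cos (2 * Real.pi * t) - 1) = 0 := by
      rw [hs] at hsc; linarith
    rcases mul_eq_zero.1 this with h' | h' <;> linarith
  rw [this]; norm_num

theorem kappaLoop_mem {t : I} (h : Real.cos (2 * Real.pi * t) ≠ 0) :
    (kappaLoop m t : Rn (m + 3)) ∈ starRegion m := by
  rw [kappaLoop_apply]
  exact planePoint_mem_starRegion
    (fun h0 ↦ by nlinarith [Real.cos_sq_le_one (2 * Real.pi * t)]) fun h0 ↦ absurd h0 h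

variable {u v w : complK1K2 (m + 3)}

/-- Only the part of a path outside of the star region matters for its loop. -/
theorem radialLoop_subpath_eq (p : Path w u) {a r s b : I} (har : a ≤ r) (hsb : s ≤ b)
    (h1 : ∀ t, a ≤ t → t ≤ r → (p t : Rn (m + 3)) ∈ starRegion m)
    (h2 : ∀ t, s ≤ t → t ≤ b → (p t : Rn (m + 3)) ∈ starRegion m) :
    radialLoop (mk (p.subpath a b)) (h1 a le_rfl har) (h2 b hsb le_rfl) =
      radialLoop (mk (p.subpath r s)) (h1 r har le_rfl) (h2 s le_rfl hsb) := by
  rw [← mk_subpath_trans p a r b, ← mk_subpath_trans p r s b,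
    radialLoop_trans (h1 r har le_rfl), radialLoop_trans (h2 s le_rfl hsb),
    radialLoop_of_mem (p.subpath a r) (p.subpath_coe_mem har h1),
    radialLoop_of_mem (p.subpath s b) (p.subpath_coe_mem hsb h2),
    refl_trans]
  exact trans_refl _

end Loops

/-! ### The ellipse as a commutator -/

section Relations

variable {m : ℕ}

variable (m) in
theorem isSphereData_zero_last : IsSphereData (0 : Fin (m + 3)) (Fin.last _) 3 :=
  .inl ⟨rfl, rfl, rfl⟩

variable (m) in
theorem isSphereData_last_zero : IsSphereData (Fin.last _) (0 : Fin (m + 3)) 2 :=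
  .inr ⟨rfl, rfl, rfl⟩

theorem mem_starRegion_of_ne {x : Rn (m + 3)} (h0 : x 0 ≠ 0) (h : x (Fin.last _) ≠ 0) :
    x ∈ starRegion m := ⟨fun h' ↦ absurd h' h, fun h' ↦ absurd h' h0⟩

/-- The parameter `k / 6`. The loops `α`, `β` and `κ` are cut at such parameters. -/
noncomputable def sixth (k : ℕ) (hk : k ≤ 6 := by norm_num) : I :=
  ⟨k / 6, by positivity, by
    rw [div_le_one (by norm_num)]; exact_mod_cast hk⟩

theorem le_sixth_iff {k : ℕ} {hk : k ≤ 6} {t : I} : t ≤ sixth k hk ↔ (t : ℝ) ≤ k / 6 := Iff.rfl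

theorem sixth_le_iff {k : ℕ} {hk : k ≤ 6} {t : I} : sixth k hk ≤ t ↔ (k / 6 : ℝ) ≤ t := Iff.rfl

theorem coe_sixth {k : ℕ} {hk : k ≤ 6} : ((sixth k hk : I) : ℝ) = k / 6 := rfl

variable {u w : complK1K2 (m + 3)} {hu : (u : Rn (m + 3)) ∈ starRegion m}
  {hw : (w : Rn (m + 3)) ∈ starRegion m} {M : Set (Rn (m + 3))}

/-- Crossing `x₁ = 0` from right to left above `K₂` gives `α`. -/
theorem radialLoop_top (hM : IsOuter (0 : Fin (m + 3)) (Fin.last _) 3 1 M) (c : Path w u)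
    (hc : ∀ t, (c t : Rn (m + 3)) ∈ M) (h1 : 0 < w.1 0) (h2 : u.1 0 < 0) :
    radialLoop (mk c) hw hu = mk (alphaLoop m) := by
  have hS := isSphereData_zero_last m
  have m1 : ∀ t : I, 0 ≤ t → t ≤ sixth 2 → (alphaLoop m t : Rn (m + 3)) ∈ starRegion m :=
    fun t _ ht ↦ alphaLoop_mem (neg_one_lt_cos_of_le t.2.1
      (by rw [le_sixth_iff] at ht; norm_num at ht; linarith))
  have m2 : ∀ t : I, sixth 4 ≤ t → t ≤ 1 → (alphaLoop m t : Rn (m + 3)) ∈ starRegion m :=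
    fun t ht _ ↦ alphaLoop_mem (neg_one_lt_cos_of_ge
      (by rw [sixth_le_iff] at ht; norm_num at ht; linarith) t.2.2)
  have e1 := radialLoop_subpath_eq (alphaLoop m) unitInterval.nonneg'
    (unitInterval.le_one' : sixth 4 ≤ 1) m1 m2
  have e2 := radialLoop_subpath_zero_one (hw := origin_mem) (hu := origin_mem) (alphaLoop m)
  rw [radialLoop_origin] at e2
  rw [← e2]
  refine Eq.trans ?_ e1.symm
  refine radialLoop_eq_of_isOuter hS (by norm_num) hM (isOuter_halfSpace hS (by norm_num)) c hc _
    (Path.subpath_coe_mem _ ?_ ?_) ?_ ?_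
  · rw [sixth_le_iff, coe_sixth]; norm_num
  · intro t h1 h2
    rw [sixth_le_iff] at h1
    rw [le_sixth_iff] at h2
    norm_num at h1 h2
    have := cos_neg_of_mem_middle h1 (by linarith)
    rw [alphaLoop_apply, mem_ofPred_eq, planePoint_last]
    linarith
  · rw [alphaLoop_apply, planePoint_zero, coe_sixth]
    have := three_quarters_lt_sin (t := 1 / 3) (by norm_num) (by norm_num)
    norm_num at this ⊢
    exact mul_pos h1 (by linarith)
  · rw [alphaLoop_apply, planePoint_zero, coe_sixth]
    have := sin_lt_neg_three_quarters (t := 2 / 3) (by norm_num) (by norm_num)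
    norm_num at this ⊢
    exact mul_pos_of_neg_of_neg h2 (by linarith)

/-- Crossing `xₙ = 0` downwards outside of `K₁`, on the side `x₁ > 0`, gives `β`. -/
theorem radialLoop_right (hM : IsOuter (Fin.last _) (0 : Fin (m + 3)) 2 1 M) (c : Path w u)
    (hc : ∀ t, (c t : Rn (m + 3)) ∈ M) (h1 : 0 < w.1 (Fin.last _)) (h2 : u.1 (Fin.last _) < 0) :
    radialLoop (mk c) hw hu = mk (betaLoop m) := by
  have hS := isSphereData_last_zero m
  have m1 : ∀ t : I, 0 ≤ t → t ≤ sixth 2 → (betaLoop m t : Rn (m + 3)) ∈ starRegion m :=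
    fun t _ ht ↦ betaLoop_mem (neg_one_lt_cos_of_le t.2.1
      (by rw [le_sixth_iff] at ht; norm_num at ht; linarith))
  have m2 : ∀ t : I, sixth 4 ≤ t → t ≤ 1 → (betaLoop m t : Rn (m + 3)) ∈ starRegion m :=
    fun t ht _ ↦ betaLoop_mem (neg_one_lt_cos_of_ge
      (by rw [sixth_le_iff] at ht; norm_num at ht; linarith) t.2.2)
  have e1 := radialLoop_subpath_eq (betaLoop m) unitInterval.nonneg'
    (unitInterval.le_one' : sixth 4 ≤ 1) m1 m2
  have e2 := radialLoop_subpath_zero_one (hw := origin_mem) (hu := origin_mem) (betaLoop m)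
  rw [radialLoop_origin] at e2
  rw [← e2]
  refine Eq.trans ?_ e1.symm
  refine radialLoop_eq_of_isOuter hS (by norm_num) hM (isOuter_halfSpace hS (by norm_num)) c hc _
    (Path.subpath_coe_mem _ ?_ ?_) ?_ ?_
  · rw [sixth_le_iff, coe_sixth]; norm_num
  · intro t h1 h2
    rw [sixth_le_iff] at h1
    rw [le_sixth_iff] at h2
    norm_num at h1 h2
    have := cos_neg_of_mem_middle h1 (by linarith)
    rw [betaLoop_apply, mem_ofPred_eq, planePoint_zero]
    linarith
  · rw [betaLoop_apply, planePoint_last, coe_sixth]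
    have := three_quarters_lt_sin (t := 1 / 3) (by norm_num) (by norm_num)
    norm_num at this ⊢
    exact mul_pos h1 (by linarith)
  · rw [betaLoop_apply, planePoint_last, coe_sixth]
    have := sin_lt_neg_three_quarters (t := 2 / 3) (by norm_num) (by norm_num)
    norm_num at this ⊢
    exact mul_pos_of_neg_of_neg h2 (by linarith)

/-- A small square around a point of the second coordinate axis, with one vertex in each of the four
quadrants of the signs of the first and the last coordinate. The two ways along its sides from
the upper left to the lower right vertex are homotopic. -/
theorem exists_square {r δ : ℝ} (hδ : 0 < δ)
    (hP : ∀ z ∈ Metric.ball (EuclideanSpace.single (1 : Fin (m + 3)) r) δ,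
      z ∉ knotK1 (m + 3) ∪ knotK2 1 (m + 3)) :
    ∃ (ul ur ll lr : complK1K2 (m + 3)) (t : Path ul ur) (r' : Path ur lr) (l : Path ul ll)
      (b : Path ll lr),
      (ul.1 0 < 0 ∧ 0 < ul.1 (Fin.last _)) ∧ (0 < ur.1 0 ∧ 0 < ur.1 (Fin.last _)) ∧
      (ll.1 0 < 0 ∧ ll.1 (Fin.last _) < 0) ∧ (0 < lr.1 0 ∧ lr.1 (Fin.last _) < 0) ∧
      (∀ s, (t s).1 ∈ Metric.ball (EuclideanSpace.single (1 : Fin (m + 3)) r) δ ∩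
        {x | 0 < 1 * x (Fin.last _)}) ∧
      (∀ s, (r' s).1 ∈ Metric.ball (EuclideanSpace.single (1 : Fin (m + 3)) r) δ ∩
        {x | 0 < 1 * x 0}) ∧
      (∀ s, (l s).1 ∈ Metric.ball (EuclideanSpace.single (1 : Fin (m + 3)) r) δ ∩
        {x | 0 < -1 * x 0}) ∧
      (∀ s, (b s).1 ∈ Metric.ball (EuclideanSpace.single (1 : Fin (m + 3)) r) δ ∩
        {x | 0 < -1 * x (Fin.last _)}) ∧
      (mk t).trans (mk r') = (mk l).trans (mk b) := by
  set B := Metric.ball (EuclideanSpace.single (1 : Fin (m + 3)) r) δ with hB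
  have hBc : Convex ℝ B := convex_ball _ _
  have hl0 : Fin.last (m + 2) ≠ 0 := by simp
  have h10 : (1 : Fin (m + 3)) ≠ 0 := by simp
  have h1l : (1 : Fin (m + 3)) ≠ Fin.last _ := by simp [Fin.ext_iff]
  have vert : ∀ a b : ℝ, |a| = δ / 4 → |b| = δ / 4 →
      ∃ v : complK1K2 (m + 3), v.1 0 = a ∧ v.1 (Fin.last _) = b ∧ v.1 ∈ B := by
    intro a b ha hb
    have hmem : EuclideanSpace.single (1 : Fin (m + 3)) r +
        (EuclideanSpace.single 0 a + EuclideanSpace.single (Fin.last _) b) ∈ B := by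
      rw [hB, mem_ball_iff_norm, add_sub_cancel_left]
      refine (norm_add_le _ _).trans_lt ?_
      rw [PiLp.norm_single, PiLp.norm_single, Real.norm_eq_abs,
        Real.norm_eq_abs, ha, hb]
      linarith
    refine ⟨⟨_, hP _ hmem⟩, ?_, ?_, hmem⟩
    · simp [h10.symm, hl0.symm]
    · simp [h1l.symm, hl0]
  have hd : |δ / 4| = δ / 4 := abs_of_pos (by positivity)
  have hd' : |-(δ / 4)| = δ / 4 := by rw [abs_neg, hd]
  obtain ⟨ul, ul0, ull, ulB⟩ := vert _ _ hd' hd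
  obtain ⟨ur, ur0, url, urB⟩ := vert _ _ hd hd
  obtain ⟨ll, ll0, lll, llB⟩ := vert _ _ hd' hd'
  obtain ⟨lr, lr0, lrl, lrB⟩ := vert _ _ hd hd'
  have hpos : 0 < δ / 4 := by positivity
  have side : ∀ (i : Fin (m + 3)) (ε : ℝ) (x y : complK1K2 (m + 3)), x.1 ∈ B → y.1 ∈ B →
      0 < ε * x.1 i → 0 < ε * y.1 i → ∃ p : Path x y, ∀ s, (p s).1 ∈ B ∩ {x | 0 < ε * x i} := by
    intro i ε x y hx hy hx' hy'
    obtain ⟨p, hp⟩ := exists_path_of_convex (hBc.inter (convex_setOf_lt_coord i 0 ε))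
      (fun z hz ↦ hP z hz.1) (x := x) (y := y) ⟨hx, hx'⟩ ⟨hy, hy'⟩
    exact ⟨p, fun s ↦ (hp s).2⟩
  obtain ⟨t, ht⟩ := side (Fin.last _) 1 ul ur ulB urB (by rw [ull]; linarith) (by rw [url]; linarith)
  obtain ⟨r', hr'⟩ := side 0 1 ur lr urB lrB (by rw [ur0]; linarith) (by rw [lr0]; linarith)
  obtain ⟨l, hl⟩ := side 0 (-1) ul ll ulB llB (by rw [ul0]; linarith) (by rw [ll0]; linarith)
  obtain ⟨b, hb⟩ := side (Fin.last _) (-1) ll lr llB lrB (by rw [lll]; linarith)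
    (by rw [lrl]; linarith)
  refine ⟨ul, ur, ll, lr, t, r', l, b, ?_, ?_, ?_, ?_, ht, hr', hl, hb, ?_⟩
  · rw [ul0, ull]; constructor <;> linarith
  · rw [ur0, url]; constructor <;> linarith
  · rw [ll0, lll]; constructor <;> linarith
  · rw [lr0, lrl]; constructor <;> linarith
  · rw [← mk_trans, ← mk_trans]
    exact mk_eq_of_convex hBc hP (Path.trans_coe_mem (fun s ↦ (ht s).1) fun s ↦ (hr' s).1)
      (Path.trans_coe_mem (fun s ↦ (hl s).1) fun s ↦ (hb s).1)

theorem abs_norm_sub_lt_of_mem_ball {r δ : ℝ} (hr : 0 ≤ r) {x : Rn (m + 3)}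
    (hx : x ∈ Metric.ball (EuclideanSpace.single (1 : Fin (m + 3)) r) δ) :
    r - δ < ‖x‖ ∧ ‖x‖ < r + δ := by
  rw [mem_ball_iff_norm] at hx
  have h1 := (abs_norm_sub_norm_le x (EuclideanSpace.single (1 : Fin (m + 3)) r)).trans_lt hx
  rw [PiLp.norm_single, Real.norm_of_nonneg hr, abs_lt] at h1
  constructor <;> linarith

/-- Crossing `xₙ = 0` downwards outside of `K₁`, on the side `x₁ < 0`, gives `β`, too. In the square
around the point of the second coordinate axis with distance `5 / 2` from the origin, the sides that
cross `x₁ = 0` do so inside of `K₂`; so they give trivial loops, and the other two sides give the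
same loop. -/
theorem radialLoop_left (hM : IsOuter (Fin.last _) (0 : Fin (m + 3)) 2 (-1) M) (c : Path w u)
    (hc : ∀ t, (c t : Rn (m + 3)) ∈ M) (h1 : 0 < w.1 (Fin.last _)) (h2 : u.1 (Fin.last _) < 0) :
    radialLoop (mk c) hw hu = mk (betaLoop m) := by
  have hn : ∀ z ∈ Metric.ball (EuclideanSpace.single (1 : Fin (m + 3)) (5 / 2 : ℝ)) (1 / 2),
      2 < ‖z‖ ∧ ‖z‖ < 3 := by
    intro z hz
    have := abs_norm_sub_lt_of_mem_ball (by norm_num) hz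
    constructor <;> linarith
  obtain ⟨ul, ur, ll, lr, t, r, l, b, hul, hur, hll, hlr, ht, hr, hl, hb, e⟩ :=
    exists_square (m := m) (r := 5 / 2) (δ := 1 / 2) (by norm_num)
      fun z hz ↦ notMem_knots_iff.2 ⟨fun _ ↦ (hn z hz).1.ne', fun _ ↦ (hn z hz).2.ne⟩
  have sul := mem_starRegion_of_ne hul.1.ne hul.2.ne'
  have sur := mem_starRegion_of_ne hur.1.ne' hur.2.ne'
  have sll := mem_starRegion_of_ne hll.1.ne hll.2.ne
  have slr := mem_starRegion_of_ne hlr.1.ne' hlr.2.ne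
  have et : radialLoop (mk t) sul sur = .refl _ := radialLoop_of_mem t fun s ↦
    ⟨fun h0 ↦ by simpa [h0] using (ht s).2, fun _ ↦ (hn _ (ht s).1).2⟩
  have eb : radialLoop (mk b) sll slr = .refl _ := radialLoop_of_mem b fun s ↦
    ⟨fun h0 ↦ by simpa [h0] using (hb s).2, fun _ ↦ (hn _ (hb s).1).2⟩
  have er : radialLoop (mk r) sur slr = mk (betaLoop m) :=
    radialLoop_right ⟨(convex_ball _ _).inter (convex_setOf_lt_coord 0 0 1), fun x hx ↦ hx.2,
      fun x hx _ ↦ (hn x hx.1).1⟩ r hr hur.2 hlr.2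
  have el : radialLoop (mk l) sul sll = mk (betaLoop m) := by
    have := congrArg (radialLoop · sul slr) e
    simp only [radialLoop_trans sur, radialLoop_trans sll, et, eb, er] at this
    rw [refl_trans] at this
    exact (this.trans (trans_refl _)).symm
  rw [← el]
  exact radialLoop_eq_of_isOuter (isSphereData_last_zero m) (by norm_num) hM
    ⟨(convex_ball _ _).inter (convex_setOf_lt_coord 0 0 (-1)), fun x hx ↦ hx.2,
      fun x hx _ ↦ (hn x hx.1).1⟩ c hc l hl (mul_pos h1 hul.2) (mul_pos_of_neg_of_neg h2 hll.2)

/-- Crossing `x₁ = 0` from left to right below `K₂` gives `β⁻¹ α⁻¹ β`. This follows from the square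
around the point of the second coordinate axis with distance `4` from the origin, the four sides of
which all cross outside of the spheres. -/
theorem radialLoop_bottom (hM : IsOuter (0 : Fin (m + 3)) (Fin.last _) 3 (-1) M) (c : Path w u)
    (hc : ∀ t, (c t : Rn (m + 3)) ∈ M) (h1 : w.1 0 < 0) (h2 : 0 < u.1 0) :
    radialLoop (mk c) hw hu =
      ((mk (betaLoop m)).symm.trans (mk (alphaLoop m)).symm).trans (mk (betaLoop m)) := by
  have hn : ∀ z ∈ Metric.ball (EuclideanSpace.single (1 : Fin (m + 3)) (4 : ℝ)) 1, 3 < ‖z‖ := by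
    intro z hz
    have := abs_norm_sub_lt_of_mem_ball (by norm_num) hz
    linarith
  obtain ⟨ul, ur, ll, lr, t, r, l, b, hul, hur, hll, hlr, ht, hr, hl, hb, e⟩ :=
    exists_square (m := m) (r := 4) (δ := 1) (by norm_num)
      fun z hz ↦ notMem_knots_iff.2 ⟨fun _ ↦ by linarith [hn z hz] |> ne_of_gt,
        fun _ ↦ (hn z hz).ne'⟩
  have sul := mem_starRegion_of_ne hul.1.ne hul.2.ne'
  have sur := mem_starRegion_of_ne hur.1.ne' hur.2.ne'
  have sll := mem_starRegion_of_ne hll.1.ne hll.2.ne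
  have slr := mem_starRegion_of_ne hlr.1.ne' hlr.2.ne
  have et : radialLoop (mk t) sul sur = (mk (alphaLoop m)).symm := by
    rw [← radialLoop_top (hw := sur) (hu := sul) ⟨(convex_ball _ _).inter
      (convex_setOf_lt_coord (Fin.last _) 0 1), fun x hx ↦ hx.2, fun x hx _ ↦ hn x hx.1⟩ t.symm
      (fun s ↦ ht _) hur.1 hul.1, mk_symm, radialLoop_symm, symm_symm]
  have er : radialLoop (mk r) sur slr = mk (betaLoop m) :=
    radialLoop_right ⟨(convex_ball _ _).inter (convex_setOf_lt_coord 0 0 1), fun x hx ↦ hx.2,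
      fun x hx _ ↦ by linarith [hn x hx.1]⟩ r hr hur.2 hlr.2
  have el : radialLoop (mk l) sul sll = mk (betaLoop m) :=
    radialLoop_left ⟨(convex_ball _ _).inter (convex_setOf_lt_coord 0 0 (-1)), fun x hx ↦ hx.2,
      fun x hx _ ↦ by linarith [hn x hx.1]⟩ l hl hul.2 hll.2
  have eb : radialLoop (mk b) sll slr =
      ((mk (betaLoop m)).symm.trans (mk (alphaLoop m)).symm).trans (mk (betaLoop m)) := by
    have := congrArg (radialLoop · sul slr) e
    simp only [radialLoop_trans sur, radialLoop_trans sll, et, el, er] at this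
    rw [trans_assoc, this, symm_trans_cancel]
  rw [← eb]
  exact radialLoop_eq_of_isOuter (isSphereData_zero_last m) (by norm_num) hM
    ⟨(convex_ball _ _).inter (convex_setOf_lt_coord (Fin.last _) 0 (-1)), fun x hx ↦ hx.2,
      fun x hx _ ↦ hn x hx.1⟩ c hc b hb (mul_pos_of_neg_of_neg h1 hll.1) (mul_pos h2 hlr.1)

/-- The ellipse represents the commutator of `α` and the inverse of `β`. It crosses `x₁ = 0` at the
parameters `1 / 4`, above `K₂`, and `3 / 4`, below `K₂`. -/
theorem gamma_kappa_homotopic :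
    (((gammaPath m).trans (kappaLoop m)).trans (gammaPath m).symm).Homotopic
      ((((alphaLoop m).trans (betaLoop m).symm).trans (alphaLoop m).symm).trans (betaLoop m)) := by
  rw [← Path.Homotopic.Quotient.eq]
  have eγ : mk (gammaPath m) = mk (ray (vertex m) vertex_mem) :=
    Path.Homotopic.Quotient.eq.2 (homotopic_of_starConvex starConvex_starRegion
      (fun _ ↦ starRegion_subset) _ _ (fun t ↦ by
        rw [gammaPath_apply]
        exact planePoint_mem_starRegion (fun _ ↦ by nlinarith [t.2.1, t.2.2]) (by norm_num))
      (ray_mem _ _))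
  have e0 : mk (((gammaPath m).trans (kappaLoop m)).trans (gammaPath m).symm) =
      radialLoop (mk (kappaLoop m)) vertex_mem vertex_mem := by
    rw [mk_trans, mk_trans, mk_symm, eγ]; rfl
  have m1 : ∀ t : I, 0 ≤ t → t ≤ sixth 1 → (kappaLoop m t : Rn (m + 3)) ∈ starRegion m :=
    fun t h1 h2 ↦ kappaLoop_mem (cos_pos_of_le h1
      (by rw [le_sixth_iff] at h2; norm_num at h2; linarith)).ne'
  have m2 : ∀ t : I, sixth 2 ≤ t → t ≤ sixth 3 → (kappaLoop m t : Rn (m + 3)) ∈ starRegion m := by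
    intro t h1 h2
    rw [sixth_le_iff] at h1
    rw [le_sixth_iff] at h2
    norm_num at h1 h2
    exact kappaLoop_mem (cos_neg_of_mem_middle h1 (by linarith)).ne
  have m3 : ∀ t : I, sixth 3 ≤ t → t ≤ sixth 4 → (kappaLoop m t : Rn (m + 3)) ∈ starRegion m := by
    intro t h1 h2
    rw [sixth_le_iff] at h1
    rw [le_sixth_iff] at h2
    norm_num at h1 h2
    exact kappaLoop_mem (cos_neg_of_mem_middle (by linarith) (by linarith)).ne
  have m4 : ∀ t : I, sixth 5 ≤ t → t ≤ 1 → (kappaLoop m t : Rn (m + 3)) ∈ starRegion m :=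
    fun t h1 h2 ↦ kappaLoop_mem (cos_pos_of_ge
      (by rw [sixth_le_iff] at h1; norm_num at h1; linarith) h2).ne'
  have l23 : sixth 2 ≤ sixth 3 := by rw [sixth_le_iff, coe_sixth]; norm_num
  have l34 : sixth 3 ≤ sixth 4 := by rw [sixth_le_iff, coe_sixth]; norm_num
  have e1 := radialLoop_subpath_eq (kappaLoop m) unitInterval.nonneg' l23 m1 m2
  have e2 := radialLoop_subpath_eq (kappaLoop m) l34 (unitInterval.le_one' : sixth 5 ≤ 1) m3 m4
  have f1 : radialLoop (mk ((kappaLoop m).subpath (sixth 1) (sixth 2)))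
      (m1 _ unitInterval.nonneg' le_rfl) (m2 _ le_rfl l23) = mk (alphaLoop m) := by
    refine radialLoop_top (isOuter_halfSpace (isSphereData_zero_last m) (by norm_num)) _
      (Path.subpath_coe_mem _ ?_ ?_) ?_ ?_
    · rw [sixth_le_iff, coe_sixth]; norm_num
    · intro t h1 h2
      rw [sixth_le_iff] at h1
      rw [le_sixth_iff] at h2
      norm_num at h1 h2
      have := three_quarters_lt_sin (t := t) (by linarith) (by linarith)
      rw [kappaLoop_apply, mem_ofPred_eq, planePoint_last]
      linarith
    · rw [kappaLoop_apply, planePoint_zero, coe_sixth]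
      exact cos_pos_of_le (by norm_num) (by norm_num)
    · rw [kappaLoop_apply, planePoint_zero, coe_sixth]
      exact cos_neg_of_mem_middle (by norm_num) (by norm_num)
  have f2 : radialLoop (mk ((kappaLoop m).subpath (sixth 4) (sixth 5))) (m3 _ l34 le_rfl)
      (m4 _ le_rfl unitInterval.le_one') =
        ((mk (betaLoop m)).symm.trans (mk (alphaLoop m)).symm).trans (mk (betaLoop m)) := by
    refine radialLoop_bottom (isOuter_halfSpace (isSphereData_zero_last m) (by norm_num)) _
      (Path.subpath_coe_mem _ ?_ ?_) ?_ ?_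
    · rw [sixth_le_iff, coe_sixth]; norm_num
    · intro t h1 h2
      rw [sixth_le_iff] at h1
      rw [le_sixth_iff] at h2
      norm_num at h1 h2
      have := sin_lt_neg_three_quarters (t := t) (by linarith) (by linarith)
      rw [kappaLoop_apply, mem_ofPred_eq, planePoint_last]
      linarith
    · rw [kappaLoop_apply, planePoint_zero, coe_sixth]
      exact cos_neg_of_mem_middle (by norm_num) (by norm_num)
    · rw [kappaLoop_apply, planePoint_zero, coe_sixth]
      exact cos_pos_of_ge (by norm_num) (by norm_num)
  rw [e0, ← radialLoop_subpath_zero_one, ← mk_subpath_trans _ 0 (sixth 3) 1,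
    radialLoop_trans (m3 _ le_rfl l34), e1, e2, f1, f2]
  simp only [mk_trans, mk_symm, trans_assoc]

end Relations

/-! ### Generation by the two loops -/

section Generation

variable {m : ℕ} {H : Subgroup (FundamentalGroup (complK1K2 (m + 3)) (origin m))}
  {i j : Fin (m + 3)} {a ε : ℝ} {M N : Set (Rn (m + 3))} {u w : complK1K2 (m + 3)}
  {hu : (u : Rn (m + 3)) ∈ starRegion m} {hw : (w : Rn (m + 3)) ∈ starRegion m}

/-- In `FundamentalGroup`, the product `p * q` is the path `q` followed by `p`. -/
theorem trans_mem {p q : Path.Homotopic.Quotient (origin m) (origin m)}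
    (hp : FundamentalGroup.fromPath p ∈ H) (hq : FundamentalGroup.fromPath q ∈ H) :
    FundamentalGroup.fromPath (p.trans q) ∈ H := H.mul_mem hq hp

theorem symm_mem {p : Path.Homotopic.Quotient (origin m) (origin m)}
    (hp : FundamentalGroup.fromPath p ∈ H) : FundamentalGroup.fromPath p.symm ∈ H := H.inv_mem hp

theorem refl_mem : FundamentalGroup.fromPath (.refl (origin m)) ∈ H := H.one_mem

variable (hα : FundamentalGroup.fromPath (mk (alphaLoop m)) ∈ H)
  (hβ : FundamentalGroup.fromPath (mk (betaLoop m)) ∈ H)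

include hα hβ

theorem radialLoop_mem_of_pos_neg (hS : IsSphereData i j a) (hε : ε = 1 ∨ ε = -1)
    (hM : IsOuter i j a ε M) (c : Path w u) (hc : ∀ t, (c t : Rn (m + 3)) ∈ M) (h1 : 0 < w.1 i)
    (h2 : u.1 i < 0) : FundamentalGroup.fromPath (radialLoop (mk c) hw hu) ∈ H := by
  rcases hS with ⟨rfl, rfl, rfl⟩ | ⟨rfl, rfl, rfl⟩ <;> rcases hε with rfl | rfl
  · rwa [radialLoop_top hM c hc h1 h2]
  · have := radialLoop_bottom (hw := hu) (hu := hw) hM c.symm (fun t ↦ hc _) h2 h1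
    rw [mk_symm, radialLoop_symm] at this
    rw [← symm_symm (radialLoop (mk c) hw hu), this]
    exact symm_mem (trans_mem (trans_mem (symm_mem hβ) (symm_mem hα)) hβ)
  · rwa [radialLoop_right hM c hc h1 h2]
  · rwa [radialLoop_left hM c hc h1 h2]

theorem radialLoop_mem_of_mul_neg (hS : IsSphereData i j a) (hε : ε = 1 ∨ ε = -1)
    (hM : IsOuter i j a ε M) (c : Path w u) (hc : ∀ t, (c t : Rn (m + 3)) ∈ M)
    (h : w.1 i * u.1 i < 0) : FundamentalGroup.fromPath (radialLoop (mk c) hw hu) ∈ H := by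
  rcases mul_neg_iff.1 h with ⟨h1, h2⟩ | ⟨h1, h2⟩
  · exact radialLoop_mem_of_pos_neg hα hβ hS hε hM c hc h1 h2
  · have := radialLoop_mem_of_pos_neg hα hβ (hw := hu) (hu := hw) hS hε hM c.symm (fun t ↦ hc _)
      h2 h1
    rw [mk_symm, radialLoop_symm] at this
    rw [← symm_symm (radialLoop (mk c) hw hu)]
    exact symm_mem this

/-- A path in a convex set on one side of `x j = 0` gives an element of a subgroup that contains `α`
and `β`, wherever it crosses `x i = 0`. -/
theorem radialLoop_mem_of_side (hS : IsSphereData i j a) (hε : ε = 1 ∨ ε = -1)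
    (hM : Convex ℝ M) (hMP : ∀ z ∈ M, z ∉ knotK1 (m + 3) ∪ knotK2 1 (m + 3))
    (hside : ∀ z ∈ M, 0 < ε * z j) (c : Path w u) (hc : ∀ t, (c t : Rn (m + 3)) ∈ M)
    (hwi : w.1 i ≠ 0) (hui : u.1 i ≠ 0) :
    FundamentalGroup.fromPath (radialLoop (mk c) hw hu) ∈ H := by
  have hwM : (w : Rn (m + 3)) ∈ M := by simpa using hc 0
  have huM : (u : Rn (m + 3)) ∈ M := by simpa using hc 1
  rcases lt_or_gt_of_ne (mul_ne_zero hwi hui) with h | h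
  · by_cases hout : ∀ x ∈ M, x i = 0 → a < ‖x‖
    · exact radialLoop_mem_of_mul_neg hα hβ hS hε ⟨hM, hside, hout⟩ c hc h
    · -- The intersection of `M` with the hyperplane `x i = 0` is connected, so that it is either
      -- inside or outside of the sphere of radius `a`.
      have hin : ∀ x ∈ M, x i = 0 → ‖x‖ < a := by
        intro x hx hxi
        by_contra! hlt
        push Not at hout
        obtain ⟨y, hy, hyi, hya⟩ := hout
        have hconv : Convex ℝ (M ∩ {z | z i = 0}) := hM.inter (convex_hyperplane
          (f := fun z : Rn (m + 3) ↦ z i) ⟨fun _ _ ↦ rfl, fun _ _ ↦ rfl⟩ 0)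
        obtain ⟨z, hz, hza⟩ := hconv.isPreconnected.intermediate_value ⟨hy, hyi⟩ ⟨hx, hxi⟩
          continuous_norm.continuousOn ⟨hya, hlt⟩
        exact hS.norm_ne (hMP z hz.1) hz.2 hza
      rw [radialLoop_of_mem c fun t ↦ hS.mem_starRegion
        (fun h0 ↦ by simpa [h0] using hside _ (hc t)) (hin _ (hc t))]
      exact refl_mem
  · rw [radialLoop_eq_refl hS hM hMP c hc (hside _ hwM) (hside _ huM) h]
    exact refl_mem

/-- A short path gives an element of a subgroup that contains `α` and `β`. Its endpoints are joined by
a path that changes first the last coordinate and then all the others. -/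
theorem radialLoop_mem_of_ball {x : Rn (m + 3)} {δ : ℝ}
    (hP : ∀ z ∈ Metric.ball x δ, z ∉ knotK1 (m + 3) ∪ knotK2 1 (m + 3))
    (hw0 : w.1 0 ≠ 0) (hwl : w.1 (Fin.last _) ≠ 0) (hu0 : u.1 0 ≠ 0) (hul : u.1 (Fin.last _) ≠ 0)
    (c : Path w u) (hc : ∀ t, (c t : Rn (m + 3)) ∈ Metric.ball x (δ / 4)) :
    FundamentalGroup.fromPath (radialLoop (mk c) hw hu) ∈ H := by
  have hconv := convex_ball x δ
  have hwx : (w : Rn (m + 3)) ∈ Metric.ball x (δ / 4) := by simpa using hc 0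
  have hux : (u : Rn (m + 3)) ∈ Metric.ball x (δ / 4) := by simpa using hc 1
  have hδ : 0 < δ := by linarith [Metric.pos_of_mem_ball hwx]
  have hsub : Metric.ball x (δ / 4) ⊆ Metric.ball x δ := Metric.ball_subset_ball (by linarith)
  have hl0 : Fin.last (m + 2) ≠ 0 := by simp
  set v' : Rn (m + 3) :=
    w.1 + EuclideanSpace.single (Fin.last _) (u.1 (Fin.last _) - w.1 (Fin.last _)) with hv'
  have hv0 : v' 0 = w.1 0 := by simp [hv', hl0.symm]
  have hvl : v' (Fin.last _) = u.1 (Fin.last _) := by simp [hv']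
  have hvx : v' ∈ Metric.ball x δ := by
    have h1 : dist v' w.1 ≤ dist u.1 w.1 := by
      rw [dist_eq_norm, dist_eq_norm, hv', add_sub_cancel_left, PiLp.norm_single]
      exact PiLp.norm_apply_le (u.1 - w.1) (Fin.last _)
    have h2 : dist u.1 w.1 ≤ dist u.1 x + dist w.1 x := dist_triangle_right _ _ _
    have h3 := dist_triangle v' w.1 x
    rw [Metric.mem_ball] at hwx hux ⊢
    linarith
  let v : complK1K2 (m + 3) := ⟨v', hP v' hvx⟩
  have hv : (v : Rn (m + 3)) ∈ starRegion m :=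
    mem_starRegion_of_ne (by rwa [hv0]) (by rwa [hvl])
  have sgn : ∀ s : ℝ, s ≠ 0 → ∃ ε : ℝ, (ε = 1 ∨ ε = -1) ∧ 0 < ε * s := by
    intro s hs
    rcases lt_or_gt_of_ne hs with h | h
    · exact ⟨-1, .inr rfl, by linarith⟩
    · exact ⟨1, .inl rfl, by linarith⟩
  obtain ⟨ε₁, hε₁, hs₁⟩ := sgn _ hw0
  obtain ⟨ε₂, hε₂, hs₂⟩ := sgn _ hul
  have hM₁ := hconv.inter (convex_setOf_lt_coord (m := m) 0 0 ε₁)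
  have hM₂ := hconv.inter (convex_setOf_lt_coord (m := m) (Fin.last _) 0 ε₂)
  obtain ⟨c₁, hc₁⟩ := exists_path_of_convex (x := w) (y := v) hM₁ (fun z hz ↦ hP z hz.1)
    ⟨hsub hwx, hs₁⟩ ⟨hvx, by change 0 < ε₁ * v' 0; rwa [hv0]⟩
  obtain ⟨c₂, hc₂⟩ := exists_path_of_convex (x := v) (y := u) hM₂ (fun z hz ↦ hP z hz.1)
    ⟨hvx, by change 0 < ε₂ * v' _; rwa [hvl]⟩ ⟨hsub hux, hs₂⟩
  have e : mk c = mk (c₁.trans c₂) := mk_eq_of_convex hconv hP (fun t ↦ hsub (hc t))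
    (Path.trans_coe_mem (fun t ↦ (hc₁ t).2.1) fun t ↦ (hc₂ t).2.1)
  rw [e, mk_trans, radialLoop_trans hv]
  refine trans_mem ?_ ?_
  · exact radialLoop_mem_of_side hα hβ (isSphereData_last_zero m) hε₁ hM₁ (fun z hz ↦ hP z hz.1)
      (fun z hz ↦ hz.2) c₁ (fun t ↦ (hc₁ t).2) hwl (by change v' _ ≠ 0; rwa [hvl])
  · exact radialLoop_mem_of_side hα hβ (isSphereData_zero_last m) hε₂ hM₂ (fun z hz ↦ hP z hz.1)
      (fun z hz ↦ hz.2) c₂ (fun t ↦ (hc₂ t).2) (by change v' _ ≠ 0; rwa [hv0]) hu0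

omit hα hβ

theorem dense_setOf_coord_ne_zero (i : Fin (m + 3)) : Dense {x : Rn (m + 3) | x i ≠ 0} := by
  have h : IsOpenMap fun x : Rn (m + 3) ↦ x i :=
    (EuclideanSpace.proj (𝕜 := ℝ) i).isOpenMap fun r ↦ ⟨EuclideanSpace.single i r, by simp⟩
  exact (dense_compl_singleton (0 : ℝ)).preimage h

theorem isOpen_setOf_coord_ne_zero (i : Fin (m + 3)) : IsOpen {x : Rn (m + 3) | x i ≠ 0} :=
  isOpen_ne_fun (by fun_prop) continuous_const

theorem exists_mem_coord_ne_zero (hN : IsOpen N) (hne : N.Nonempty) :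
    ∃ x ∈ N, x 0 ≠ 0 ∧ x (Fin.last _) ≠ 0 := by
  obtain ⟨x, hx, h⟩ := ((dense_setOf_coord_ne_zero (m := m) 0).inter_of_isOpen_left
    (dense_setOf_coord_ne_zero (Fin.last _)) (isOpen_setOf_coord_ne_zero 0)).inter_open_nonempty
      N hN hne
  exact ⟨x, hx, h⟩

theorem isOpen_compl_knots : IsOpen {x : Rn (m + 3) | x ∉ knotK1 (m + 3) ∪ knotK2 1 (m + 3)} := by
  have h : IsClosed (knotK1 (m + 3) ∪ knotK2 1 (m + 3)) := by
    have h1 : knotK1 (m + 3) = {x | x (Fin.last _) = 0 ∧ ‖x‖ = 2} := Set.ext fun _ ↦ mem_knotK1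
    have h2 : knotK2 1 (m + 3) = {x | x 0 = 0 ∧ ‖x‖ = 3} := Set.ext fun _ ↦ mem_knotK2
    rw [h1, h2]
    refine IsClosed.union ?_ ?_ <;>
    exact (isClosed_eq (by fun_prop) continuous_const).inter
      (isClosed_eq continuous_norm continuous_const)
  exact h.isOpen_compl

include hα hβ in
/-- The fundamental group of the complement is generated by `α` and `β`. -/
theorem mem_of_alpha_beta_mem (g : FundamentalGroup (complK1K2 (m + 3)) (origin m)) : g ∈ H := by
  -- The property `good` singles out the small balls, inside which `radialLoop_mem_of_ball` applies.
  let good (N : Set (Rn (m + 3))) : Prop := ∃ x δ, N = Metric.ball x (δ / 4) ∧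
    ∀ z ∈ Metric.ball x δ, z ∉ knotK1 (m + 3) ∪ knotK2 1 (m + 3)
  have good_notMem : ∀ N, good N → ∀ z ∈ N, z ∉ knotK1 (m + 3) ∪ knotK2 1 (m + 3) := by
    rintro _ ⟨x, δ, rfl, h⟩ z hz
    exact h z (Metric.ball_subset_ball (by linarith [Metric.pos_of_mem_ball hz]) hz)
  have good_convex : ∀ N, good N → Convex ℝ N := by
    rintro _ ⟨x, δ, rfl, h⟩; exact convex_ball _ _
  have good_open : ∀ N, good N → IsOpen N := by
    rintro _ ⟨x, δ, rfl, h⟩; exact Metric.isOpen_ball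
  have good_mem : ∀ N, good N → ∀ (w u : complK1K2 (m + 3)) (hw0 : w.1 0 ≠ 0)
      (hwl : w.1 (Fin.last _) ≠ 0) (hu0 : u.1 0 ≠ 0) (hul : u.1 (Fin.last _) ≠ 0) (c : Path w u)
      (hc : ∀ t, (c t : Rn (m + 3)) ∈ N), FundamentalGroup.fromPath
        (radialLoop (mk c) (mem_starRegion_of_ne hw0 hwl) (mem_starRegion_of_ne hu0 hul)) ∈ H := by
    rintro _ ⟨x, δ, rfl, h⟩ w u hw0 hwl hu0 hul c hc
    exact radialLoop_mem_of_ball hα hβ h hw0 hwl hu0 hul c hc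
  have good_exists : ∀ x : complK1K2 (m + 3), ∃ N, good N ∧ (x : Rn (m + 3)) ∈ N := by
    intro x
    obtain ⟨δ, hδ, h⟩ := Metric.isOpen_iff.1 isOpen_compl_knots x.1 x.2
    exact ⟨_, ⟨x, δ, rfl, fun z hz ↦ h hz⟩, Metric.mem_ball_self (by positivity)⟩
  -- The members of `A x` consist of a radial path to a point off the hyperplanes and of a short path.
  let A (x : complK1K2 (m + 3)) : Set (Path.Homotopic.Quotient (origin m) x) :=
    {q | ∃ N, good N ∧ ∃ (w : complK1K2 (m + 3)) (hw0 : w.1 0 ≠ 0) (hwl : w.1 (Fin.last _) ≠ 0)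
      (c : Path w x), (∀ t, (c t : Rn (m + 3)) ∈ N) ∧
        q = (mk (ray w (mem_starRegion_of_ne hw0 hwl))).trans (mk c)}
  refine mem_of_locally_admissible H A ?_ ?_ ?_ g
  · obtain ⟨N, hN, hoN⟩ := good_exists (origin m)
    obtain ⟨w, hwN, hw0, hwl⟩ := exists_mem_coord_ne_zero (good_open N hN) ⟨_, hoN⟩
    lift w to complK1K2 (m + 3) using good_notMem N hN w hwN
    refine ⟨N, hN, w, hw0, hwl, (ray w (mem_starRegion_of_ne hw0 hwl)).symm, fun t ↦ ?_, ?_⟩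
    · exact (good_convex N hN).segment_subset hoN hwN
        (segmentPath_mem (origin m) w (fun _ hz ↦ starRegion_subset
          (starConvex_starRegion.segment_subset (mem_starRegion_of_ne hw0 hwl) hz)) _)
    · rw [mk_symm, trans_symm]
  · rintro x _ ⟨N, hN, w, hw0, hwl, c, hc, rfl⟩ _ ⟨N', hN', w', hw0', hwl', c', hc', rfl⟩
    have hxN : (x : Rn (m + 3)) ∈ N := by simpa using hc 1
    have hxN' : (x : Rn (m + 3)) ∈ N' := by simpa using hc' 1
    obtain ⟨u, ⟨huN, huN'⟩, hu0, hul⟩ := exists_mem_coord_ne_zero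
      ((good_open N hN).inter (good_open N' hN')) ⟨_, hxN, hxN'⟩
    lift u to complK1K2 (m + 3) using good_notMem N hN u huN
    obtain ⟨d, hd⟩ := exists_path_of_convex ((good_convex N hN).inter (good_convex N' hN'))
      (fun z hz ↦ good_notMem N hN z hz.1) (x := x) (y := u) ⟨hxN, hxN'⟩ ⟨huN, huN'⟩
    have h1 := good_mem N hN w u hw0 hwl hu0 hul (c.trans d)
      (Path.trans_coe_mem hc fun t ↦ (hd t).2.1)
    have h2 := good_mem N' hN' w' u hw0' hwl' hu0 hul (c'.trans d)
      (Path.trans_coe_mem hc' fun t ↦ (hd t).2.2)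
    convert trans_mem h1 (symm_mem h2) using 1
    simp only [radialLoop, mk_trans, symm_trans_rev, symm_symm, trans_assoc, symm_trans_cancel,
      trans_symm_cancel]
  · intro x
    obtain ⟨N, hN, hxN⟩ := good_exists x
    refine ⟨Subtype.val ⁻¹' N, (good_open N hN).preimage continuous_subtype_val, hxN, ?_⟩
    intro z z' p hp
    have hzN : (z : Rn (m + 3)) ∈ N := by simpa using hp 0
    obtain ⟨w, hwN, hw0, hwl⟩ := exists_mem_coord_ne_zero (good_open N hN) ⟨_, hxN⟩
    lift w to complK1K2 (m + 3) using good_notMem N hN w hwN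
    obtain ⟨c, hc⟩ := exists_path_of_convex (good_convex N hN) (good_notMem N hN)
      (x := w) (y := z) hwN hzN
    refine ⟨_, ⟨N, hN, w, hw0, hwl, c, fun t ↦ (hc t).2, rfl⟩, N, hN, w, hw0, hwl, c.trans p,
      Path.trans_coe_mem (fun t ↦ (hc t).2) hp, ?_⟩
    rw [mk_trans, trans_assoc]

end Generation

/-! ### Freeness -/

theorem IsCoveringMap.monodromy_symm_apply {E X : Type*} [TopologicalSpace E] [TopologicalSpace X]
    {p : E → X} (cov : IsCoveringMap p) {x y : X} (γ : Path.Homotopic.Quotient x y) {e : p ⁻¹' {x}}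
    {e' : p ⁻¹' {y}} (h : cov.monodromy γ e = e') : cov.monodromy γ.symm e' = e := by
  rw [← h, ← cov.monodromy_trans_apply, trans_symm, cov.monodromy_refl]; rfl

section Freeness

variable {m : ℕ}

variable (m) in
/-- The two charts of the covering. The chart `true` is the complement of the disc
`{xₙ = 0, ‖x‖ ≤ 2}` and of the exterior region `{x₁ = 0, ‖x‖ ≥ 3}`; the chart `false` is a
neighbourhood of what these two sets contain of the complement of the spheres. -/
def chart : Bool → Set (complK1K2 (m + 3))
  | true => {x | (x.1 (Fin.last _) = 0 → 2 < ‖x.1‖) ∧ (x.1 0 = 0 → ‖x.1‖ < 3)}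
  | false => {x | ‖x.1‖ < 2 ∨ 3 < ‖x.1‖}

theorem isOpen_chart (b : Bool) : IsOpen (chart m b) := by
  have hn : Continuous fun x : complK1K2 (m + 3) ↦ ‖x.1‖ := by fun_prop
  have hc : ∀ i, IsOpen {x : complK1K2 (m + 3) | x.1 i ≠ 0} := fun i ↦
    isOpen_compl_singleton.preimage (f := fun x : complK1K2 (m + 3) ↦ x.1 i) (by fun_prop)
  cases b
  · exact (isOpen_lt hn continuous_const).union (isOpen_lt continuous_const hn)
  · have : chart m true = ({x | x.1 (Fin.last _) ≠ 0} ∪ {x | 2 < ‖x.1‖}) ∩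
        ({x | x.1 0 ≠ 0} ∪ {x | ‖x.1‖ < 3}) := by
      ext x
      simp only [chart, mem_ofPred_eq, mem_inter_iff, mem_union, imp_iff_not_or, ne_eq]
    rw [this]
    exact ((hc _).union (isOpen_lt continuous_const hn)).inter
      ((hc _).union (isOpen_lt hn continuous_const))

theorem chart_cover (x : complK1K2 (m + 3)) (hx : x ∉ chart m true) : x ∈ chart m false := by
  obtain ⟨h2, h3⟩ := notMem_knots_iff.1 x.2
  simp only [chart, mem_ofPred_eq, not_and_or, Classical.not_imp, not_lt] at hx ⊢
  rcases hx with ⟨h, hx⟩ | ⟨h, hx⟩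
  · exact .inl (lt_of_le_of_ne hx (h2 h))
  · exact .inr (lt_of_le_of_ne hx (h3 h).symm)

variable {G : Type} [Group G] (a b : G)

/-- The transition function of the covering: crossing the disc `{xₙ = 0, ‖x‖ < 2}` upwards
multiplies by `b`, and crossing `{x₁ = 0, ‖x‖ > 3}` from right to left multiplies by `a`. -/
noncomputable def transition (x : complK1K2 (m + 3)) : G :=
  if ‖x.1‖ < 2 then (if x.1 (Fin.last _) < 0 then b⁻¹ else 1) else (if x.1 0 < 0 then a else 1)

theorem continuousOn_transition [TopologicalSpace G] :
    ContinuousOn (transition (m := m) a b) (chart m true ∩ chart m false) := by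
  have hn : Continuous fun x : complK1K2 (m + 3) ↦ ‖x.1‖ := by fun_prop
  have hc : ∀ i, Continuous fun x : complK1K2 (m + 3) ↦ x.1 i := by intro i; fun_prop
  rintro x ⟨⟨hx1, hx2⟩, hx3⟩
  refine ContinuousAt.continuousWithinAt ?_
  rcases hx3 with hx | hx
  · have e1 := hn.continuousAt.eventually_lt continuousAt_const hx
    rcases lt_or_gt_of_ne fun h ↦ (hx1 h).not_gt hx with hl | hl
    · refine (continuousAt_const (y := b⁻¹)).congr ?_
      filter_upwards [e1, (hc (Fin.last _)).continuousAt.eventually_lt continuousAt_const hl]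
        with z h1 h2
      simp [transition, h1, h2]
    · refine (continuousAt_const (y := 1)).congr ?_
      filter_upwards [e1, continuousAt_const.eventually_lt (hc (Fin.last _)).continuousAt hl]
        with z h1 h2
      simp [transition, h1, h2.not_gt]
  · have e1 := continuousAt_const.eventually_lt hn.continuousAt hx
    rcases lt_or_gt_of_ne fun h ↦ (hx2 h).not_gt hx with hl | hl
    · refine (continuousAt_const (y := a)).congr ?_
      filter_upwards [e1, (hc 0).continuousAt.eventually_lt continuousAt_const hl]
        with z h1 h2
      have h1 : ¬ ‖z.1‖ < 2 := by linarith
      simp [transition, h1, h2]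
    · refine (continuousAt_const (y := 1)).congr ?_
      filter_upwards [e1, continuousAt_const.eventually_lt (hc 0).continuousAt hl]
        with z h1 h2
      have h1 : ¬ ‖z.1‖ < 2 := by linarith
      simp [transition, h1, h2.not_gt]

theorem exists_planePoint (s t : ℝ) (hs : s ≠ 0) (ht : t ≠ 0) :
    ∃ x : complK1K2 (m + 3), x.1 = planePoint (m + 3) s t :=
  ⟨⟨_, planePoint_notMem (fun h ↦ absurd h ht) fun h ↦ absurd h hs⟩, rfl⟩

/-- Given two elements `a` and `b` of a group, there is a covering of the complement on whose fibre
over the origin, which is a copy of the group, the loops `α` and `β` act by left multiplication with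
`a` and `b`. -/
theorem exists_monodromy :
    ∃ (F : Type) (φ : FundamentalGroup (complK1K2 (m + 3)) (origin m) →* Equiv.Perm F)
      (pt : G → F), Function.Injective pt ∧
      (∀ v, φ (FundamentalGroup.fromPath (mk (alphaLoop m))) (pt v) = pt (a * v)) ∧
      (∀ v, φ (FundamentalGroup.fromPath (mk (betaLoop m))) (pt v) = pt (b * v)) := by
  let _ : TopologicalSpace G := ⊥
  have : DiscreteTopology G := ⟨rfl⟩
  have cov := isCoveringMap_clutchingBundle (U := chart m) (hU := isOpen_chart)
    (hcover := chart_cover) (hg := continuousOn_transition a b)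
  let pt := clutchingPoint (U := chart m) isOpen_chart chart_cover (continuousOn_transition a b)
  have pt_true : ∀ x v, pt true x (transition a b x * v) = pt false x v := clutchingPoint_true
  have along : ∀ (i : Bool) {x y : complK1K2 (m + 3)} (p : Path x y) (hp : ∀ t, p t ∈ chart m i)
    (v : G), cov.monodromy (mk p) (pt i x v) = pt i y v := fun i _ _ p hp v ↦
      monodromy_clutchingPoint i p hp v
  -- A radial path starts inside of the ball of radius `2`, and there it leaves the disc at once.
  have along_ray : ∀ (y : complK1K2 (m + 3)) (h0 : y.1 0 ≠ 0) (hl : y.1 (Fin.last _) ≠ 0) (v : G),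
      cov.monodromy (mk (ray y (mem_starRegion_of_ne h0 hl))) (pt false (origin m) v) =
        pt true y ((if y.1 (Fin.last _) < 0 then b⁻¹ else 1) * v) := by
    intro y h0 hl v
    have hpos : 0 < 1 / (1 + ‖y.1‖) := by positivity
    set s := 1 / (1 + ‖y.1‖) with hs
    have hsy : ‖s • y.1‖ < 2 := by
      rw [norm_smul, Real.norm_of_nonneg hpos.le, hs, one_div_mul_eq_div,
        div_lt_iff₀ (by positivity)]
      linarith [norm_nonneg y.1]
    have hz0 : (s • y.1) 0 ≠ 0 := by simp [hpos.ne', h0]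
    have hzl : (s • y.1) (Fin.last _) ≠ 0 := by simp [hpos.ne', hl]
    obtain ⟨z, hz⟩ : ∃ z : complK1K2 (m + 3), z.1 = s • y.1 :=
      ⟨⟨_, starRegion_subset (mem_starRegion_of_ne hz0 hzl)⟩, rfl⟩
    have hB : ∀ x ∈ Metric.ball (0 : Rn (m + 3)) 2, x ∈ starRegion m := by
      intro x hx
      rw [mem_ball_zero_iff] at hx
      exact ⟨fun _ ↦ hx, fun _ ↦ by linarith⟩
    obtain ⟨p, hp⟩ := exists_path_of_convex (x := origin m) (y := z) (convex_ball 0 2)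
      (fun x hx ↦ starRegion_subset (hB x hx)) (Metric.mem_ball_self (by norm_num))
      (by rw [hz, mem_ball_zero_iff]; exact hsy)
    have hQ : ∀ x ∈ {x : Rn (m + 3) | 0 < y.1 0 * x 0} ∩
          {x | 0 < y.1 (Fin.last _) * x (Fin.last _)},
        x 0 ≠ 0 ∧ x (Fin.last _) ≠ 0 := fun x hx ↦
      ⟨right_ne_zero_of_mul (ne_of_gt hx.1), right_ne_zero_of_mul (ne_of_gt hx.2)⟩
    obtain ⟨q, hq⟩ := exists_path_of_convex (x := z) (y := y)
      ((convex_setOf_lt_coord 0 0 (y.1 0)).inter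
        (convex_setOf_lt_coord (Fin.last _) 0 (y.1 (Fin.last _))))
      (fun x hx ↦ starRegion_subset (mem_starRegion_of_ne (hQ x hx).1 (hQ x hx).2))
      (by
        rw [hz]
        refine ⟨?_, ?_⟩
        · change 0 < y.1 0 * (s * y.1 0)
          nlinarith [mul_pos hpos (mul_self_pos.2 h0)]
        · change 0 < y.1 (Fin.last _) * (s * y.1 (Fin.last _))
          nlinarith [mul_pos hpos (mul_self_pos.2 hl)])
      ⟨mul_self_pos.2 h0, mul_self_pos.2 hl⟩
    have e : mk (ray y (mem_starRegion_of_ne h0 hl)) = mk (p.trans q) := by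
      refine Path.Homotopic.Quotient.eq.2 (homotopic_of_starConvex starConvex_starRegion
        (fun _ ↦ starRegion_subset) _ _ (ray_mem _ _) (Path.trans_coe_mem (fun t ↦ hB _ (hp t).2)
        fun t ↦ mem_starRegion_of_ne (hQ _ (hq t).2).1 (hQ _ (hq t).2).2))
    have hgz : transition a b z = if y.1 (Fin.last _) < 0 then b⁻¹ else 1 := by
      have : z.1 (Fin.last _) < 0 ↔ y.1 (Fin.last _) < 0 := by
        rw [hz]; change s * y.1 _ < 0 ↔ _
        exact ⟨fun h ↦ neg_of_mul_neg_right h hpos.le, fun h ↦ mul_neg_of_pos_of_neg hpos h⟩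
      simp only [transition, hz ▸ hsy, if_true, this]
    rw [e, mk_trans, cov.monodromy_trans_apply, along false p fun t ↦ .inl (by
        simpa using (hp t).2), ← pt_true, hgz, along true q]
    exact fun t ↦ ⟨fun h ↦ absurd h (hQ _ (hq t).2).2, fun h ↦ absurd h (hQ _ (hq t).2).1⟩
  -- The action of a loop obtained from a path between two points off the coordinate hyperplanes.
  have along_loop : ∀ (w u : complK1K2 (m + 3)) (hw0 : w.1 0 ≠ 0) (hwl : w.1 (Fin.last _) ≠ 0)
      (hu0 : u.1 0 ≠ 0) (hul : u.1 (Fin.last _) ≠ 0) (c : Path w u) (v v' : G),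
      cov.monodromy (mk c) (pt true w ((if w.1 (Fin.last _) < 0 then b⁻¹ else 1) * v)) =
        pt true u ((if u.1 (Fin.last _) < 0 then b⁻¹ else 1) * v') →
      cov.monodromy (radialLoop (mk c) (mem_starRegion_of_ne hw0 hwl)
        (mem_starRegion_of_ne hu0 hul)) (pt false (origin m) v) = pt false (origin m) v' := by
    intro w u hw0 hwl hu0 hul c v v' h
    rw [radialLoop, cov.monodromy_trans_apply, cov.monodromy_trans_apply, along_ray w hw0 hwl, h]
    exact cov.monodromy_symm_apply _ (along_ray u hu0 hul _)
  obtain ⟨y₁, hy₁⟩ := exists_planePoint (m := m) 4 4 (by norm_num) (by norm_num)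
  obtain ⟨y₂, hy₂⟩ := exists_planePoint (m := m) (-4) 4 (by norm_num) (by norm_num)
  obtain ⟨y₃, hy₃⟩ := exists_planePoint (m := m) 4 (-4) (by norm_num) (by norm_num)
  have h10 : y₁.1 0 = 4 := by rw [hy₁, planePoint_zero]
  have h1l : y₁.1 (Fin.last _) = 4 := by rw [hy₁, planePoint_last]
  have h20 : y₂.1 0 = -4 := by rw [hy₂, planePoint_zero]
  have h2l : y₂.1 (Fin.last _) = 4 := by rw [hy₂, planePoint_last]
  have h30 : y₃.1 0 = 4 := by rw [hy₃, planePoint_zero]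
  have h3l : y₃.1 (Fin.last _) = -4 := by rw [hy₃, planePoint_last]
  have n10 : y₁.1 0 ≠ 0 := by rw [h10]; norm_num
  have n1l : y₁.1 (Fin.last _) ≠ 0 := by rw [h1l]; norm_num
  have n20 : y₂.1 0 ≠ 0 := by rw [h20]; norm_num
  have n2l : y₂.1 (Fin.last _) ≠ 0 := by rw [h2l]; norm_num
  have n30 : y₃.1 0 ≠ 0 := by rw [h30]; norm_num
  have n3l : y₃.1 (Fin.last _) ≠ 0 := by rw [h3l]; norm_num
  have hT := isOuter_halfSpace (isSphereData_zero_last m) (ε := 1) (by norm_num)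
  have hR := isOuter_halfSpace (isSphereData_last_zero m) (ε := 1) (by norm_num)
  obtain ⟨c, hc⟩ := exists_path_of_convex (x := y₁) (y := y₂) hT.convex
    (hT.notMem (isSphereData_zero_last m)) (by change 3 < 1 * y₁.1 _; rw [h1l]; norm_num)
    (by change 3 < 1 * y₂.1 _; rw [h2l]; norm_num)
  obtain ⟨d, hd⟩ := exists_path_of_convex (x := y₁) (y := y₃) hR.convex
    (hR.notMem (isSphereData_last_zero m)) (by change 2 < 1 * y₁.1 _; rw [h10]; norm_num)
    (by change 2 < 1 * y₃.1 _; rw [h30]; norm_num)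
  have three_lt : ∀ x : Rn (m + 3), 3 < 1 * x (Fin.last _) → 3 < ‖x‖ := fun x hx ↦
    (lt_of_lt_of_le (by linarith) (le_abs_self _)).trans_le (PiLp.norm_apply_le x (Fin.last _))
  have two_lt : ∀ x : Rn (m + 3), 2 < 1 * x 0 → 2 < ‖x‖ := fun x hx ↦
    (lt_of_lt_of_le (by linarith) (le_abs_self _)).trans_le (PiLp.norm_apply_le x 0)
  have pt_inj : Function.Injective (pt false (origin m)) := clutchingPoint_injective _ _
  refine ⟨_, cov.monodromyPerm (origin m), pt false (origin m), pt_inj,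
    fun v ↦ ?_, fun v ↦ ?_⟩
  · rw [← radialLoop_top (hw := mem_starRegion_of_ne n10 n1l) (hu := mem_starRegion_of_ne n20 n2l)
      hT c (fun t ↦ (hc t).2) (by rw [h10]; norm_num)
      (by rw [h20]; norm_num)]
    refine along_loop y₁ y₂ n10 n1l n20 n2l c v (a * v) ?_
    have n1 : ¬ ‖y₁.1‖ < 2 := by linarith [three_lt y₁.1 (by rw [h1l]; norm_num)]
    have n2 : ¬ ‖y₂.1‖ < 2 := by linarith [three_lt y₂.1 (by rw [h2l]; norm_num)]
    have g1 : transition a b y₁ = 1 := by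
      rw [transition, if_neg n1, h10, if_neg (by norm_num)]
    have g2 : transition a b y₂ = a := by
      rw [transition, if_neg n2, h20, if_pos (by norm_num)]
    have e1 := pt_true y₁ v
    have e2 := pt_true y₂ v
    rw [g1] at e1
    rw [g2] at e2
    rw [h1l, h2l, if_neg (by norm_num), e1, one_mul, e2]
    exact along false c (fun t ↦ .inr (three_lt _ (hc t).2)) v
  · rw [← radialLoop_right (hw := mem_starRegion_of_ne n10 n1l) (hu := mem_starRegion_of_ne n30 n3l)
      hR d (fun t ↦ (hd t).2) (by rw [h1l]; norm_num)
      (by rw [h3l]; norm_num)]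
    refine along_loop y₁ y₃ n10 n1l n30 n3l d v (b * v) ?_
    rw [h1l, h3l, if_neg (by norm_num), if_pos (by norm_num), one_mul, inv_mul_cancel_left]
    refine along true d (fun t ↦ ⟨fun _ ↦ two_lt _ (hd t).2, fun h ↦ ?_⟩) v
    have := (hd t).2
    rw [mem_ofPred_eq, h] at this
    norm_num at this

variable (m) in
/-- The homomorphism from the free group on two generators that sends these to `α` and `β`. -/
noncomputable def freeGroupHom :
    FreeGroup (Fin 2) →* FundamentalGroup (complK1K2 (m + 3)) (origin m) :=
  FreeGroup.lift ![FundamentalGroup.fromPath (mk (alphaLoop m)),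
    FundamentalGroup.fromPath (mk (betaLoop m))]

theorem freeGroupHom_zero : freeGroupHom m (FreeGroup.of 0) =
    FundamentalGroup.fromPath (mk (alphaLoop m)) := by simp [freeGroupHom]

theorem freeGroupHom_one : freeGroupHom m (FreeGroup.of 1) =
    FundamentalGroup.fromPath (mk (betaLoop m)) := by simp [freeGroupHom]

/-- With `G` the free group itself, a word `x` acts on the fibre by left multiplication, and can be
read off from its action on the point `1`. -/
theorem freeGroupHom_injective : Function.Injective (freeGroupHom m) := by
  obtain ⟨F, φ, pt, hpt, hα, hβ⟩ := exists_monodromy (m := m) (FreeGroup.of (0 : Fin 2))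
    (FreeGroup.of 1)
  have hgen : ∀ (i : Fin 2) v, φ (freeGroupHom m (FreeGroup.of i)) (pt v) =
      pt (FreeGroup.of i * v) := by
    intro i v
    fin_cases i
    · exact freeGroupHom_zero (m := m) ▸ hα v
    · exact freeGroupHom_one (m := m) ▸ hβ v
  have key : ∀ (x : FreeGroup (Fin 2)) v, φ (freeGroupHom m x) (pt v) = pt (x * v) := by
    intro x
    induction x using FreeGroup.induction_on with
    | C1 => intro v; rw [map_one, map_one, Equiv.Perm.one_apply, one_mul]
    | of i => exact hgen i
    | inv_of i ih =>
      intro v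
      rw [map_inv, map_inv, Equiv.Perm.inv_eq_iff_eq, hgen, mul_inv_cancel_left]
    | mul x y hx hy => intro v; rw [map_mul, map_mul, Equiv.Perm.mul_apply, hy, hx, mul_assoc]
  refine (injective_iff_map_eq_one _).2 fun x hx ↦ ?_
  have := key x 1
  rw [hx, map_one, Equiv.Perm.one_apply, mul_one] at this
  exact (hpt this).symm

theorem freeGroupHom_surjective : Function.Surjective (freeGroupHom m) := fun g ↦
  mem_of_alpha_beta_mem (H := (freeGroupHom m).range) ⟨_, freeGroupHom_zero⟩ ⟨_, freeGroupHom_one⟩ g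

/-- The ellipse is not null-homotopic, because `β α⁻¹ β⁻¹ α ≠ 1` in the free group. -/
theorem kappa_not_homotopic_refl :
    ¬ (((gammaPath m).trans (kappaLoop m)).trans (gammaPath m).symm).Homotopic
      (Path.refl (origin m)) := by
  intro h
  have h1 := Path.Homotopic.Quotient.eq.2 (gamma_kappa_homotopic.symm.trans h)
  -- The product in `FundamentalGroup` composes paths from right to left, which reverses the word.
  have h2 : freeGroupHom m (FreeGroup.of 1 * ((FreeGroup.of 0)⁻¹ *
      ((FreeGroup.of 1)⁻¹ * FreeGroup.of 0))) = 1 := by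
    simp only [map_mul, map_inv, freeGroupHom_zero, freeGroupHom_one]
    exact h1
  rw [← map_one (freeGroupHom m)] at h2
  have h3 := freeGroupHom_injective h2
  revert h3
  decide

end Freeness

/-! ### Links -/

section Links

variable {n : ℕ}

theorem BoundsBall.subset {K B : Set (Rn n)} (h : BoundsBall K B) : K ⊆ B := by
  obtain ⟨k, f, -, -, rfl, rfl⟩ := h
  exact image_mono Metric.sphere_subset_closedBall

theorem BoundsBall.isKnot {K B : Set (Rn n)} (h : BoundsBall K B) : IsKnot K := by
  obtain ⟨k, f, hf, hinj, rfl, rfl⟩ := h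
  have hs : Metric.sphere (0 : Rn (k + 1)) 1 ⊆ Metric.closedBall 0 1 :=
    Metric.sphere_subset_closedBall
  have := isCompact_iff_compactSpace.1 (isCompact_sphere (0 : Rn (k + 1)) 1)
  have he := ((hf.mono hs).domRestrict.isClosedEmbedding (hinj.mono hs).injective).isEmbedding
  exact ⟨k, ⟨(he.toHomeomorph.trans (Homeomorph.setCongr (range_domRestrict _ _))).symm⟩⟩

/-- A family of three sets is a convex Brunnian link as soon as it is not an unlink, every member
bounds a convex ball, and of any two members the first bounds a ball that misses the second. -/
theorem isConvexBrunnianLink_of_forall_pair {F : Fin 3 → Set (Rn n)}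
    (hpair : ∀ i j, i ≠ j → ∃ B, BoundsBall (F i) B ∧ Disjoint B (F j))
    (hconv : ∀ i, ∃ B, BoundsBall (F i) B ∧ Convex ℝ B) (hF : ¬ IsUnlink F) :
    IsConvexBrunnianLink F := by
  have hknot : ∀ i, IsKnot (F i) := fun i ↦ let ⟨_, hB, _⟩ := hconv i; hB.isKnot
  have hdisj : ∀ i j, i ≠ j → Disjoint (F i) (F j) := fun i j hij ↦
    let ⟨_, hB, hd⟩ := hpair i j hij; hd.mono_left hB.subset
  refine ⟨⟨⟨hknot, hdisj⟩, by simp, hF, fun s hs ↦ ⟨⟨fun i ↦ hknot i, fun i j hij ↦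
    hdisj i j (Subtype.coe_injective.ne hij)⟩, fun i ↦ ?_⟩⟩, fun i ↦ ⟨hknot i, hconv i⟩⟩
  obtain ⟨k, hk⟩ := (ne_univ_iff_exists_notMem s).1 hs
  have third : ∀ i k : Fin 3, i ≠ k → ∃ j, i ≠ j ∧ ∀ l, l ≠ i → l ≠ k → l = j := by decide
  obtain ⟨j, hij, hj⟩ := third i k fun h ↦ hk (h ▸ i.2)
  obtain ⟨B, hB, hd⟩ := hpair i j hij
  refine ⟨B, hB, fun l hl ↦ ?_⟩
  have hlj := hj l (Subtype.coe_injective.ne hl) fun h ↦ hk (h ▸ l.2)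
  change Disjoint B (F l)
  rwa [hlj]

variable {k : ℕ} (τ : Fin k ↪ Fin n) (w : Fin k → ℝ)

/-- The linear map that sends the basis vector with index `a` to `w a` times the basis vector with
index `τ a`. -/
noncomputable def axisMap : Rn k →L[ℝ] Rn n :=
  ∑ a, w a • (EuclideanSpace.proj a : Rn k →L[ℝ] ℝ).smulRight (EuclideanSpace.single (τ a) (1 : ℝ))

variable {τ w}

theorem axisMap_apply_mem (y : Rn k) (a : Fin k) : axisMap τ w y (τ a) = w a * y a := by
  simp [axisMap, Pi.single_apply, Finset.sum_apply]

theorem axisMap_apply_of_notMem (y : Rn k) {j : Fin n} (hj : j ∉ range τ) :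
    axisMap τ w y j = 0 := by
  have : ∀ a, j ≠ τ a := fun a h ↦ hj ⟨a, h.symm⟩
  simp [axisMap, this]

theorem axisMap_injective (hw : ∀ a, w a ≠ 0) : Function.Injective (axisMap τ w) := by
  intro y y' h
  ext a
  have := congrArg (fun x : Rn n ↦ x (τ a)) h
  simpa [axisMap_apply_mem, hw] using this

/-- The image of the unit sphere under `axisMap` is an ellipsoid in a coordinate subspace. -/
theorem mem_image_axisMap_sphere (hw : ∀ a, w a ≠ 0) {x : Rn n} :
    x ∈ axisMap τ w '' Metric.sphere 0 1 ↔
      (∀ j ∉ range τ, x j = 0) ∧ ∑ a, (x (τ a) / w a) ^ 2 = 1 := by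
  constructor
  · rintro ⟨y, hy, rfl⟩
    refine ⟨fun j hj ↦ axisMap_apply_of_notMem y hj, ?_⟩
    rw [mem_sphere_zero_iff_norm, norm_eq_iff_sum_sq zero_le_one (s := 1) (by norm_num)] at hy
    simpa [axisMap_apply_mem, mul_div_cancel_left₀, hw] using hy
  · rintro ⟨h0, h1⟩
    refine ⟨WithLp.toLp 2 fun a ↦ x (τ a) / w a, ?_, ?_⟩
    · rw [mem_sphere_zero_iff_norm, norm_eq_iff_sum_sq zero_le_one (s := 1) (by norm_num)]
      exact h1
    · ext j
      by_cases hj : j ∈ range τ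
      · obtain ⟨a, rfl⟩ := hj
        rw [axisMap_apply_mem]
        exact mul_div_cancel₀ _ (hw a)
      · rw [axisMap_apply_of_notMem _ hj, h0 j hj]

variable (τ w) in
/-- The unit ball, embedded by `axisMap` and then bulged in the direction of the coordinate with
index `i`, up to height `c`, with its boundary kept fixed. -/
noncomputable def dome (i : Fin n) (c : ℝ) (y : Rn k) : Rn n :=
  axisMap τ w y + EuclideanSpace.single i (c * √(1 - ‖y‖ ^ 2))

variable {i : Fin n} {c : ℝ}

theorem dome_apply_mem (hi : i ∉ range τ) (y : Rn k) (a : Fin k) :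
    dome τ w i c y (τ a) = w a * y a := by
  have : τ a ≠ i := fun h ↦ hi ⟨a, h⟩
  simp [dome, axisMap_apply_mem, this]

theorem dome_apply_self (hi : i ∉ range τ) (y : Rn k) :
    dome τ w i c y i = c * √(1 - ‖y‖ ^ 2) := by
  simp [dome, axisMap_apply_of_notMem y hi]

theorem dome_apply_of_notMem {j : Fin n} (hj : j ∉ range τ) (hji : j ≠ i) (y : Rn k) :
    dome τ w i c y j = 0 := by
  simp [dome, axisMap_apply_of_notMem y hj, hji]

theorem norm_sq_dome (hi : i ∉ range τ) {y : Rn k} (hy : ‖y‖ ^ 2 ≤ 1) :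
    ‖dome τ w i c y‖ ^ 2 = ∑ a, (w a * y a) ^ 2 + c ^ 2 * (1 - ‖y‖ ^ 2) := by
  have hi' : i ∉ Finset.univ.map τ := by simpa using hi
  rw [EuclideanSpace.real_norm_sq_eq,
    ← Finset.sum_subset (Finset.subset_univ (insert i (Finset.univ.map τ))) fun j _ hj ↦ by
      simp only [Finset.mem_insert, Finset.mem_map, Finset.mem_univ, true_and, not_or] at hj
      rw [dome_apply_of_notMem hj.2 hj.1]; norm_num,
    Finset.sum_insert hi', Finset.sum_map, dome_apply_self hi, mul_pow,
    Real.sq_sqrt (by linarith), add_comm]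
  simp only [dome_apply_mem hi]

theorem boundsBall_dome {k : ℕ} {τ : Fin (k + 1) ↪ Fin n} {w : Fin (k + 1) → ℝ}
    (hw : ∀ a, w a ≠ 0) (hi : i ∉ range τ) (c : ℝ) :
    BoundsBall (axisMap τ w '' Metric.sphere 0 1) (dome τ w i c '' Metric.closedBall 0 1) := by
  refine ⟨k, dome τ w i c, ?_, ?_, rfl, ?_⟩
  · have : Continuous fun y : Rn (k + 1) ↦ EuclideanSpace.single i (c * √(1 - ‖y‖ ^ 2)) := by
      refine (PiLp.continuous_toLp 2 _).comp ?_
      exact (continuous_single i).comp (by fun_prop)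
    exact ((axisMap τ w).continuous.add this).continuousOn
  · intro y _ y' _ h
    refine axisMap_injective (τ := τ) hw ?_
    ext j
    by_cases hj : j ∈ range τ
    · obtain ⟨a, rfl⟩ := hj
      rw [axisMap_apply_mem, axisMap_apply_mem, ← dome_apply_mem hi, h, dome_apply_mem hi]
    · rw [axisMap_apply_of_notMem _ hj, axisMap_apply_of_notMem _ hj]
  · refine image_congr fun y hy ↦ ?_
    rw [mem_sphere_zero_iff_norm] at hy
    simp [dome, hy]

theorem convex_dome_zero : Convex ℝ (dome τ w i 0 '' Metric.closedBall 0 1) := by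
  have : dome τ w i 0 = axisMap τ w := by ext1 y; simp [dome]
  rw [this]
  exact (convex_closedBall 0 1).linear_image (axisMap τ w).toLinearMap

end Links

/-! ### The three knots -/

section Components

variable {m : ℕ}

theorem norm_sq_of_mem_knotK3 {x : Rn (m + 3)} (hx : x ∈ knotK3 1 (m + 3)) :
    ‖x‖ ^ 2 = x 0 ^ 2 + x (Fin.last _) ^ 2 := by
  obtain ⟨-, h⟩ := mem_knotK3.1 hx
  rw [EuclideanSpace.real_norm_sq_eq, Finset.sum_eq_add (0 : Fin (m + 3)) (Fin.last _)
    (by simp [Fin.ext_iff]) (fun j _ hj ↦ by rw [h j hj.1 hj.2]; norm_num) (by simp) (by simp)]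

variable (m) in
/-- The two coordinate directions of the plane of the ellipse. -/
def zeroLastEmb : Fin 2 ↪ Fin (m + 3) where
  toFun := ![0, Fin.last _]
  inj' := by
    intro a b
    fin_cases a <;> fin_cases b <;> simp [Fin.ext_iff]

theorem zeroLastEmb_zero : zeroLastEmb m 0 = 0 := rfl

theorem zeroLastEmb_one : zeroLastEmb m 1 = Fin.last _ := rfl

theorem mem_range_zeroLastEmb {j : Fin (m + 3)} :
    j ∈ range (zeroLastEmb m) ↔ j = 0 ∨ j = Fin.last _ := by
  simp [zeroLastEmb_zero, zeroLastEmb_one, eq_comm]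

theorem last_notMem_range_castSucc :
    Fin.last (m + 2) ∉ range (Fin.castSuccEmb (n := m + 2)) := by
  rintro ⟨a, ha⟩
  exact Fin.castSucc_ne_last a ha

theorem zero_notMem_range_succ : (0 : Fin (m + 3)) ∉ range (Fin.succEmb (m + 2)) := by
  rintro ⟨a, ha⟩
  exact Fin.succ_ne_zero a ha

theorem one_notMem_range_zeroLastEmb : (1 : Fin (m + 3)) ∉ range (zeroLastEmb m) := by
  rw [mem_range_zeroLastEmb]
  simp [Fin.ext_iff]

theorem knotK1_eq : knotK1 (m + 3) =
    axisMap (Fin.castSuccEmb (n := m + 2)) (fun _ ↦ 2) '' Metric.sphere 0 1 := by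
  ext x
  rw [mem_image_axisMap_sphere fun _ ↦ two_ne_zero, mem_knotK1,
    norm_eq_iff_sum_sq zero_le_two (s := 4) (by norm_num)]
  have h : (∀ j ∉ range (Fin.castSuccEmb (n := m + 2)), x j = 0) ↔
      x (Fin.last _) = 0 := by
    refine ⟨fun h ↦ h _ last_notMem_range_castSucc, fun h j hj ↦ ?_⟩
    rcases Fin.eq_castSucc_or_eq_last j with ⟨a, rfl⟩ | rfl
    · exact absurd ⟨a, rfl⟩ hj
    · exact h
  rw [h]
  refine and_congr_right fun h0 ↦ ?_
  rw [Fin.sum_univ_castSucc, h0]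
  simp only [div_pow, ← Finset.sum_div]
  rw [div_eq_iff (by norm_num)]
  norm_num

theorem knotK2_eq : knotK2 1 (m + 3) =
    axisMap (Fin.succEmb (m + 2)) (fun _ ↦ 3) '' Metric.sphere 0 1 := by
  ext x
  rw [mem_image_axisMap_sphere fun _ ↦ three_ne_zero, mem_knotK2,
    norm_eq_iff_sum_sq zero_le_three (s := 9) (by norm_num)]
  have h : (∀ j ∉ range (Fin.succEmb (m + 2)), x j = 0) ↔ x 0 = 0 := by
    refine ⟨fun h ↦ h _ zero_notMem_range_succ, fun h j hj ↦ ?_⟩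
    rcases Fin.eq_zero_or_eq_succ j with rfl | ⟨a, rfl⟩
    · exact h
    · exact absurd ⟨a, rfl⟩ hj
  rw [h]
  refine and_congr_right fun h0 ↦ ?_
  rw [Fin.sum_univ_succ, h0]
  simp only [div_pow, ← Finset.sum_div]
  rw [div_eq_iff (by norm_num)]
  norm_num

theorem axes_ne_zero (a : Fin 2) : (![1, 4] : Fin 2 → ℝ) a ≠ 0 := by
  fin_cases a <;> norm_num

theorem knotK3_eq : knotK3 1 (m + 3) = axisMap (zeroLastEmb m) ![1, 4] '' Metric.sphere 0 1 := by
  ext x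
  rw [mem_image_axisMap_sphere axes_ne_zero, mem_knotK3, and_comm]
  simp only [mem_range_zeroLastEmb, not_or, and_imp, Fin.sum_univ_two]
  refine and_congr_right fun _ ↦ ?_
  simp [zeroLastEmb_zero, zeroLastEmb_one, div_pow]
  norm_num

/-- Each of the three knots bounds a ball that misses a given other one. A flat ball does in the cases
`(1, 2)`, `(2, 3)` and `(3, 1)`. The heights `8` and `3` in the cases `(1, 3)` and `(2, 1)` and the
height `4` in the case `(3, 2)` make the ball part of an ellipsoid that encloses the ellipse, of the
sphere of radius `3`, and of an ellipsoid that meets `x₁ = 0` in points of norm `4` only. -/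
theorem exists_boundsBall_linkL {i j : Fin 3} (hij : i ≠ j) :
    ∃ B, BoundsBall (linkL 1 (m + 3) i) B ∧ Disjoint B (linkL 1 (m + 3) j) := by
  have hsq : ∀ {k : ℕ} {y : Rn k}, y ∈ Metric.closedBall 0 1 → ‖y‖ ^ 2 ≤ 1 := fun hy ↦
    pow_le_one₀ (norm_nonneg _) (mem_closedBall_zero_iff.1 hy)
  have hsum : ∀ {k : ℕ} (r : ℝ) (y : Rn k), ∑ a, (r * y a) ^ 2 = r ^ 2 * ‖y‖ ^ 2 := by
    intro k r y
    simp only [EuclideanSpace.real_norm_sq_eq, Finset.mul_sum, mul_pow]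
  have h12 : ∃ B, BoundsBall (knotK1 (m + 3)) B ∧ Disjoint B (knotK2 1 (m + 3)) := by
    refine ⟨_, knotK1_eq (m := m) ▸ boundsBall_dome (fun _ ↦ two_ne_zero)
      last_notMem_range_castSucc 0, disjoint_left.2 ?_⟩
    rintro _ ⟨y, hy, rfl⟩ hx
    have h := norm_sq_dome (w := fun _ ↦ 2) (c := 0) (last_notMem_range_castSucc (m := m)) (hsq hy)
    rw [(mem_knotK2.1 hx).2, hsum] at h
    linarith [hsq hy]
  have h13 : ∃ B, BoundsBall (knotK1 (m + 3)) B ∧ Disjoint B (knotK3 1 (m + 3)) := by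
    refine ⟨_, knotK1_eq (m := m) ▸ boundsBall_dome (fun _ ↦ two_ne_zero)
      last_notMem_range_castSucc 8, disjoint_left.2 ?_⟩
    rintro _ ⟨y, hy, rfl⟩ hx
    have h := norm_sq_dome (w := fun _ ↦ 2) (c := 8) (last_notMem_range_castSucc (m := m)) (hsq hy)
    have h' := (mem_knotK3.1 hx).1
    rw [norm_sq_of_mem_knotK3 hx, hsum] at h
    rw [dome_apply_self last_notMem_range_castSucc, mul_pow,
      Real.sq_sqrt (by linarith [hsq hy])] at h h'
    linarith
  have h21 : ∃ B, BoundsBall (knotK2 1 (m + 3)) B ∧ Disjoint B (knotK1 (m + 3)) := by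
    refine ⟨_, knotK2_eq (m := m) ▸ boundsBall_dome (fun _ ↦ three_ne_zero)
      zero_notMem_range_succ 3, disjoint_left.2 ?_⟩
    rintro _ ⟨y, hy, rfl⟩ hx
    have h := norm_sq_dome (w := fun _ ↦ 3) (c := 3) (zero_notMem_range_succ (m := m)) (hsq hy)
    rw [(mem_knotK1.1 hx).2, hsum] at h
    linarith [hsq hy]
  have h23 : ∃ B, BoundsBall (knotK2 1 (m + 3)) B ∧ Disjoint B (knotK3 1 (m + 3)) := by
    refine ⟨_, knotK2_eq (m := m) ▸ boundsBall_dome (fun _ ↦ three_ne_zero)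
      zero_notMem_range_succ 0, disjoint_left.2 ?_⟩
    rintro _ ⟨y, hy, rfl⟩ hx
    have h := norm_sq_dome (w := fun _ ↦ 3) (c := 0) (zero_notMem_range_succ (m := m)) (hsq hy)
    have h' := (mem_knotK3.1 hx).1
    rw [norm_sq_of_mem_knotK3 hx, hsum] at h
    rw [dome_apply_self zero_notMem_range_succ] at h h'
    linarith [hsq hy]
  have h31 : ∃ B, BoundsBall (knotK3 1 (m + 3)) B ∧ Disjoint B (knotK1 (m + 3)) := by
    refine ⟨_, knotK3_eq (m := m) ▸ boundsBall_dome axes_ne_zero one_notMem_range_zeroLastEmb 0,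
      disjoint_left.2 ?_⟩
    rintro _ ⟨y, hy, rfl⟩ hx
    have h := norm_sq_dome (w := ![1, 4]) (c := 0) (one_notMem_range_zeroLastEmb (m := m)) (hsq hy)
    have h' := dome_apply_mem (w := ![1, 4]) (c := 0) (one_notMem_range_zeroLastEmb (m := m)) y 1
    have hy' := hsq hy
    rw [EuclideanSpace.real_norm_sq_eq, Fin.sum_univ_two] at hy'
    rw [(mem_knotK1.1 hx).2, Fin.sum_univ_two] at h
    change dome (zeroLastEmb m) ![1, 4] 1 0 y (Fin.last _) = 4 * y 1 at h'
    rw [(mem_knotK1.1 hx).1] at h'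
    have h1 : y 1 = 0 := by linarith
    rw [h1] at h hy'
    norm_num at h
    linarith
  have h32 : ∃ B, BoundsBall (knotK3 1 (m + 3)) B ∧ Disjoint B (knotK2 1 (m + 3)) := by
    refine ⟨_, knotK3_eq (m := m) ▸ boundsBall_dome axes_ne_zero one_notMem_range_zeroLastEmb 4,
      disjoint_left.2 ?_⟩
    rintro _ ⟨y, hy, rfl⟩ hx
    have h := norm_sq_dome (w := ![1, 4]) (c := 4) (one_notMem_range_zeroLastEmb (m := m)) (hsq hy)
    have h' := dome_apply_mem (w := ![1, 4]) (c := 4) (one_notMem_range_zeroLastEmb (m := m)) y 0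
    rw [(mem_knotK2.1 hx).2, EuclideanSpace.real_norm_sq_eq, Fin.sum_univ_two,
      Fin.sum_univ_two] at h
    change dome (zeroLastEmb m) ![1, 4] 1 4 y 0 = 1 * y 0 at h'
    rw [(mem_knotK2.1 hx).1] at h'
    have h0 : y 0 = 0 := by linarith
    simp [h0] at h
    linarith
  fin_cases i <;> fin_cases j <;> first | exact absurd rfl hij | assumption

/-- The flat balls are convex. -/
theorem exists_boundsBall_convex_linkL (i : Fin 3) :
    ∃ B, BoundsBall (linkL 1 (m + 3) i) B ∧ Convex ℝ B := by
  fin_cases i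
  · exact ⟨_, knotK1_eq (m := m) ▸ boundsBall_dome (fun _ ↦ two_ne_zero)
      last_notMem_range_castSucc 0, convex_dome_zero⟩
  · exact ⟨_, knotK2_eq (m := m) ▸ boundsBall_dome (fun _ ↦ three_ne_zero)
      zero_notMem_range_succ 0, convex_dome_zero⟩
  · exact ⟨_, knotK3_eq (m := m) ▸ boundsBall_dome axes_ne_zero
      one_notMem_range_zeroLastEmb 0, convex_dome_zero⟩

theorem exists_angle {u s : ℝ} (h : u ^ 2 + s ^ 2 = 1) :
    ∃ t : I, Real.cos (2 * Real.pi * t) = u ∧ Real.sin (2 * Real.pi * t) = s := by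
  have hn : ‖(⟨u, s⟩ : ℂ)‖ = 1 := by
    rw [Complex.norm_def, Complex.normSq_mk, ← sq, ← sq, h, Real.sqrt_one]
  have h0 : (⟨u, s⟩ : ℂ) ≠ 0 := norm_ne_zero_iff.1 (hn.trans_ne one_ne_zero)
  set θ := Complex.arg ⟨u, s⟩ with hθ
  have e : 2 * Real.pi * Int.fract (θ / (2 * Real.pi)) =
      θ - ⌊θ / (2 * Real.pi)⌋ * (2 * Real.pi) := by
    rw [Int.fract, mul_sub, mul_div_cancel₀ _ Real.two_pi_pos.ne', mul_comm _ (⌊_⌋ : ℝ)]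
  refine ⟨⟨Int.fract (θ / (2 * Real.pi)), Int.fract_nonneg _, (Int.fract_lt_one _).le⟩, ?_, ?_⟩
  · change Real.cos (2 * Real.pi * Int.fract _) = u
    rw [e, Real.cos_sub_int_mul_two_pi, hθ, Complex.cos_arg h0, hn, div_one]
  · change Real.sin (2 * Real.pi * Int.fract _) = s
    rw [e, Real.sin_sub_int_mul_two_pi, hθ, Complex.sin_arg, hn, div_one]

theorem range_kappaLoop :
    range (fun t : I ↦ (kappaLoop m t : Rn (m + 3))) = knotK3 1 (m + 3) := by
  ext x
  rw [mem_knotK3]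
  constructor
  · rintro ⟨t, rfl⟩
    simp only [kappaLoop_apply]
    refine ⟨?_, fun j h0 hl ↦ planePoint_of_ne _ _ h0 hl⟩
    rw [planePoint_zero, planePoint_last]
    linarith [Real.sin_sq_add_cos_sq (2 * Real.pi * t)]
  · rintro ⟨h, hx⟩
    obtain ⟨t, hc, hs⟩ := exists_angle (u := x 0) (s := x (Fin.last _) / 4) (by linarith)
    refine ⟨t, ?_⟩
    simp only [kappaLoop_apply, hc, hs]
    ext j
    rcases eq_or_ne j 0 with rfl | h0
    · rw [planePoint_zero]
    rcases eq_or_ne j (Fin.last _) with rfl | hl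
    · rw [planePoint_last]; ring
    rw [planePoint_of_ne _ _ h0 hl, hx j h0 hl]

/-- A loop that factors through a simply connected space is null-homotopic. -/
theorem Path.homotopic_refl_of_map {X Y : Type*} [TopologicalSpace X] [TopologicalSpace Y]
    [SimplyConnectedSpace Y] {f : Y → X} (hf : Continuous f) {x : X} {y : Y} (p : Path x x)
    (q : Path y y) (h : ∀ t, f (q t) = p t) : p.Homotopic (Path.refl x) := by
  obtain rfl : f y = x := by rw [← q.source, h, p.source]
  have h1 : p = q.map hf := by ext t; exact (h t).symm
  have h2 : Path.refl (f y) = (Path.refl y).map hf := by ext t; rfl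
  rw [h1, h2]
  exact Path.Homotopic.map (SimplyConnectedSpace.paths_homotopic _ _) ⟨f, hf⟩

/-- A ball bounded by the ellipse that misses both spheres would contract the ellipse in the
complement of the spheres, which `kappa_not_homotopic_refl` excludes. -/
theorem not_isUnlink_linkL : ¬ IsUnlink (linkL 1 (m + 3)) := by
  rintro ⟨-, h⟩
  obtain ⟨B, ⟨k, f, hf, hinj, rfl, hK⟩, hB⟩ := h 2
  have h1 : Disjoint _ (knotK1 (m + 3)) := hB 0 (by decide)
  have h2 : Disjoint _ (knotK2 1 (m + 3)) := hB 1 (by decide)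
  change f '' _ = knotK3 1 (m + 3) at hK
  have hmem : ∀ y : Metric.closedBall (0 : Rn (k + 1)) 1,
      f y ∉ knotK1 (m + 3) ∪ knotK2 1 (m + 3) := by
    rintro y (hy | hy)
    · exact disjoint_left.1 h1 (mem_image_of_mem f y.2) hy
    · exact disjoint_left.1 h2 (mem_image_of_mem f y.2) hy
  let F : Metric.closedBall (0 : Rn (k + 1)) 1 → complK1K2 (m + 3) := fun y ↦ ⟨f y, hmem y⟩
  have hF : Continuous F := hf.domRestrict.subtype_mk _
  have := isCompact_iff_compactSpace.1 (isCompact_closedBall (0 : Rn (k + 1)) 1)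
  have := (convex_closedBall (0 : Rn (k + 1)) 1).contractibleSpace
    (Metric.nonempty_closedBall.2 zero_le_one)
  have hFe : Topology.IsEmbedding F := (hF.isClosedEmbedding fun y y' h ↦
    hinj.injective (congrArg Subtype.val h)).isEmbedding
  have hr : ∀ t, kappaLoop m t ∈ range F := by
    intro t
    have : (kappaLoop m t : Rn (m + 3)) ∈ f '' Metric.sphere 0 1 := by
      rw [hK, ← range_kappaLoop]
      exact ⟨t, rfl⟩
    obtain ⟨y, hy, hyt⟩ := this
    exact ⟨⟨y, Metric.sphere_subset_closedBall hy⟩, Subtype.ext hyt⟩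
  choose g hg using hr
  have hgc : Continuous g := by
    rw [hFe.continuous_iff]
    exact (kappaLoop m).continuous.congr fun t ↦ (hg t).symm
  have h01 : g 1 = g 0 := hFe.injective (by rw [hg, hg, Path.target, Path.source])
  let q : Path (g 0) (g 0) := ⟨⟨g, hgc⟩, rfl, h01⟩
  have hnull := Path.homotopic_refl_of_map hF (kappaLoop m) q hg
  refine kappa_not_homotopic_refl (m := m) (Path.Homotopic.Quotient.eq.1 ?_)
  rw [mk_trans, mk_trans, Path.Homotopic.Quotient.eq.2 hnull, mk_symm]
  exact (congrArg (fun c ↦ Path.Homotopic.Quotient.trans c _) (trans_refl _)).trans (trans_symm _)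

end Components

theorem theorem2 (n : ℕ) (hn : 3 ≤ n) :
    IsConvexBrunnianLink (linkL 1 n) ∧
    ∃ (o p : complK1K2 n) (α β : Path o o) (γ : Path o p) (κ : Path p p),
      -- the loops `α`, `β` at the origin, the segment `γ` and the parametrized ellipse `κ`
      (∀ t : I, (α t : Rn n) =
        planePoint n (3 * Real.sin (2 * Real.pi * t)) (3 - 3 * Real.cos (2 * Real.pi * t))) ∧
      (∀ t : I, (β t : Rn n) =
        planePoint n (2 - 2 * Real.cos (2 * Real.pi * t)) (2 * Real.sin (2 * Real.pi * t))) ∧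
      (∀ t : I, (γ t : Rn n) = planePoint n t 0) ∧
      (∀ t : I, (κ t : Rn n) =
        planePoint n (Real.cos (2 * Real.pi * t)) (4 * Real.sin (2 * Real.pi * t))) ∧
      Set.range (fun t : I => (κ t : Rn n)) = knotK3 1 n ∧
      -- the fundamental group of the complement is free on the classes of `α` and `β`
      (∃ e : FreeGroup (Fin 2) ≃* FundamentalGroup (complK1K2 n) o,
        e (FreeGroup.of 0) = FundamentalGroup.fromPath (Path.Homotopic.Quotient.mk α) ∧
        e (FreeGroup.of 1) = FundamentalGroup.fromPath (Path.Homotopic.Quotient.mk β)) ∧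
      -- the ellipse represents the commutator `α β⁻¹ α⁻¹ β`, which is nontrivial
      ((γ.trans κ).trans γ.symm).Homotopic (((α.trans β.symm).trans α.symm).trans β) ∧
      ¬ ((γ.trans κ).trans γ.symm).Homotopic (Path.refl o) := by
  obtain ⟨m, rfl⟩ : ∃ m, n = m + 3 := ⟨n - 3, by omega⟩
  exact ⟨isConvexBrunnianLink_of_forall_pair (fun _ _ ↦ exists_boundsBall_linkL)
      exists_boundsBall_convex_linkL not_isUnlink_linkL,
    origin m, vertex m, alphaLoop m, betaLoop m, gammaPath m, kappaLoop m,
    alphaLoop_apply, betaLoop_apply, gammaPath_apply, kappaLoop_apply, range_kappaLoop,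
    ⟨MulEquiv.ofBijective (freeGroupHom m) ⟨freeGroupHom_injective, freeGroupHom_surjective⟩,
      freeGroupHom_zero, freeGroupHom_one⟩, gamma_kappa_homotopic, kappa_not_homotopic_refl⟩
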